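/- All graphs are finite, simple and undirected. For a graph $H$ let $\Delta(H)$ be its maximum degree and $\omega(H)$ its clique number, and for $W\subseteq V(H)$ let $H[W]$ be the subgraph induced by $W$. A graph is $K_p$-free if it contains no copy of the complete graph $K_p$, and $\chi_{K_p}(H)$ is the least integer $k$ for which $V(H)$ can be partitioned into $k$ sets each inducing a $K_p$-free subgraph. Let $H$ be a graph with $\omega(H)\le\Delta(H)-1$. 1. Suppose that $\Delta(H)\ge 6$, and let $k\ge 1$ and let $p_1\ge p_2\ge\cdots\ge p_k\ge 2$ be integers with $p_1\ge 4$ and $\sum_{i=1}^k p_i=\Delta(H)-1+k$. Then $V(H)$ can be partitioned into non-empty sets $V_1,\dots,V_k$ such that $H[V_i]$ is $K_{p_i}$-free for each $1\le i\le k$. 2. For every integer $p\ge 4$, $$\chi_{K_p}(H)\le\left\lceil\frac{\Delta(H)-1}{p-1}\right\rceil .$$ -/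

import Mathlib

/-- `W 0, …, W (k-1)` is a partition of the whole vertex set `V` into `k` (non-empty, pairwise
disjoint) parts. -/
structure IsVertexPartition {V : Type*} {k : ℕ} (W : Fin k → Set V) : Prop where
  nonempty : ∀ i, (W i).Nonempty
  disjoint : ∀ i j, i ≠ j → Disjoint (W i) (W j)
  cover : ⋃ i, W i = Set.univ

/-- `V(H)` can be partitioned into `k` sets, each inducing a subgraph of `H` that contains no copy
of `G`. -/
def HasFreePartition {V U : Type*} (G : SimpleGraph U) (H : SimpleGraph V) (k : ℕ) : Prop :=
  ∃ W : Fin k → Set V, IsVertexPartition W ∧ ∀ i, G.Free (H.induce (W i))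

/-- The `G`-free chromatic number `χ_G(H)`: the least `k` such that `V(H)` can be partitioned into
`k` sets each inducing a `G`-free subgraph of `H` (and `⊤` if there is no such `k`). -/
noncomputable def freeChromaticNumber {V U : Type*} (G : SimpleGraph U) (H : SimpleGraph V) : ℕ∞ :=
  ⨅ k ∈ {k : ℕ | HasFreePartition G H k}, (k : ℕ∞)

/-! Write Δ = m + 4 with m ≥ 2. The graph has no clique on m + 4 vertices. It suffices to remove m
independent sets so that no `4`-clique survives (`hasMixedColoring_of_cliqueFree`): a class with
bound p_1 takes the remainder, of clique number at most 3, and p_1 - 4 of the independent sets;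
every other class takes p_i - 1 of them, and Σ p_i = Δ - 1 + k makes the count exact.

One removal lowers the pair (degree bound, forbidden clique) from (q + 1, q + 1) to (q, q). The set
removed must be maximal independent, so that all other degrees drop, and must hit every `q`-clique.
By the degree bound, two meeting `q`-cliques share at least q - 2 vertices. For q ≥ 5 meeting is
therefore transitive, and all cliques of a meeting class share a large common core with few
neighbours outside the class (`CliqueSystem.core_bounds`). A lopsided Haxell argument
(`exists_independent_hitting_family`) picks one independent vertex from each core.

The last removal, q = 4, is the difficulty: 4-cliques can overlap in pairs of vertices along a
chain. A chain can be contracted to a single clique (`exists_hitting_of_no_blobClosed`) unless the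
chains close up into a "blob", where every vertex lies in two 4-cliques sharing two vertices. The
preceding removal, q = 5, is therefore made to hit all minimal blobs as well
(`exists_maximal_independent_hitting_blobs`). Blobs away from the 5-cliques have cores that join the
transversal problem; the others are hit afterwards by local exchanges.

For the chromatic bound, equal parts and one remainder part are used. The only case with Δ < 6 that
is not immediate is Δ = 5, p = 4. -/

/-! ### Independent transversals. -/

/-- The constructive form of Haxell's theorem: a partial transversal `f` of the classes in `R`
extends to `A` after exchanges, unless some subfamily together with `A` is dominated by few
vertices. -/
theorem transversal_or_dominated {V ι : Type*} [DecidableEq V] [DecidableEq ι]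
    (G : SimpleGraph V) (n : ℕ) :
    ∀ (U : ι → Finset V) (A : Finset V) (R : Finset ι), R.card = n → ∀ f : ι → V,
      (∀ i ∈ R, f i ∈ U i) → (∀ i ∈ R, ∀ j ∈ R, ¬ G.Adj (f i) (f j)) →
      (∃ a ∈ A, ∃ g : ι → V, (∀ i ∈ R, g i ∈ U i) ∧ (∀ i ∈ R, ∀ j ∈ R, ¬ G.Adj (g i) (g j)) ∧
        ∀ i ∈ R, ¬ G.Adj a (g i)) ∨
      (∃ S ⊆ R, ∃ g : ι → V, ∃ X : Finset V, (∀ i ∈ S, g i ∈ U i) ∧ X.card ≤ S.card ∧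
        (∀ x ∈ X, x ∈ A ∨ ∃ i ∈ S, x ∈ U i) ∧
        ∀ v, (v ∈ A ∨ ∃ i ∈ S, v ∈ U i) → ∃ z, (z ∈ X ∨ ∃ i ∈ S, z = g i) ∧ G.Adj z v) := by
  classical
  induction n using Nat.strong_induction_on with
  | _ n ih =>
  intro U A R hR
  by_cases hA : A = ∅
  · intro f _ _
    refine Or.inr ⟨∅, by simp, f, ∅, by simp, by simp, by simp, ?_⟩
    simp [hA]
  obtain ⟨x, hx⟩ := Finset.nonempty_iff_ne_empty.2 hA
  -- The vertex `x` stays fixed while `f` is exchanged; the inner induction is on the number of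
  -- representatives adjacent to `x`.
  suffices H : ∀ m : ℕ, ∀ f : ι → V, (R.filter (fun i => G.Adj x (f i))).card = m →
      (∀ i ∈ R, f i ∈ U i) → (∀ i ∈ R, ∀ j ∈ R, ¬ G.Adj (f i) (f j)) →
      (∃ a ∈ A, ∃ g : ι → V, (∀ i ∈ R, g i ∈ U i) ∧ (∀ i ∈ R, ∀ j ∈ R, ¬ G.Adj (g i) (g j)) ∧
        ∀ i ∈ R, ¬ G.Adj a (g i)) ∨
      (∃ S ⊆ R, ∃ g : ι → V, ∃ X : Finset V, (∀ i ∈ S, g i ∈ U i) ∧ X.card ≤ S.card ∧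
        (∀ x ∈ X, x ∈ A ∨ ∃ i ∈ S, x ∈ U i) ∧
        ∀ v, (v ∈ A ∨ ∃ i ∈ S, v ∈ U i) → ∃ z, (z ∈ X ∨ ∃ i ∈ S, z = g i) ∧ G.Adj z v) by
    intro f h1 h2
    exact H _ f rfl h1 h2
  intro m
  induction m using Nat.strong_induction_on with
  | _ m ihm =>
  intro f hm hf hind
  set Y := R.filter (fun i => G.Adj x (f i)) with hY
  have hYR : Y ⊆ R := Finset.filter_subset _ _
  have memY : ∀ i, i ∈ Y ↔ i ∈ R ∧ G.Adj x (f i) := fun i => Finset.mem_filter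
  by_cases hY0 : Y = ∅
  · refine Or.inl ⟨x, hx, f, hf, hind, fun i hi h => ?_⟩
    have : i ∈ Y := (memY i).2 ⟨hi, h⟩
    simp [hY0] at this
  have hYpos : 0 < Y.card := Finset.card_pos.2 (Finset.nonempty_iff_ne_empty.2 hY0)
  -- The classes of `Y` block `x`. Recursion on the other classes looks for a vertex of `A` or of a
  -- blocking class, using only vertices not dominated by `x` and the blocking representatives.
  let ok : V → Prop := fun v => ¬ G.Adj x v ∧ ∀ i ∈ Y, ¬ G.Adj (f i) v
  let A' : Finset V := (A ∪ Y.biUnion U).filter ok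
  let U' : ι → Finset V := fun i => (U i).filter ok
  have hcard : (R \ Y).card < n := by
    rw [Finset.card_sdiff_of_subset hYR]
    have := Finset.card_le_card hYR
    omega
  have key := ih _ hcard U' A' (R \ Y) rfl f
    (by
      intro i hi
      rw [Finset.mem_sdiff, memY] at hi
      refine Finset.mem_filter.2 ⟨hf i hi.1, fun h => hi.2 ⟨hi.1, h⟩, fun j hj => ?_⟩
      exact hind j (hYR hj) i hi.1)
    (by
      intro i hi j hj
      exact hind i (Finset.mem_sdiff.1 hi).1 j (Finset.mem_sdiff.1 hj).1)
  rcases key with ⟨a, ha, g, hg, hgind, hga⟩ | ⟨S, hS, g, X, hg, hX, hXm, hdom⟩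
  · obtain ⟨ha, hax, haY⟩ := Finset.mem_filter.1 ha
    have hg' : ∀ i ∈ R, i ∉ Y → g i ∈ U i ∧ ¬ G.Adj x (g i) ∧ ∀ j ∈ Y, ¬ G.Adj (f j) (g i) := by
      intro i hi hiY
      have := Finset.mem_filter.1 (hg i (Finset.mem_sdiff.2 ⟨hi, hiY⟩))
      exact ⟨this.1, this.2⟩
    have hgind' : ∀ i ∈ R, i ∉ Y → ∀ j ∈ R, j ∉ Y → ¬ G.Adj (g i) (g j) := by
      intro i hi hiY j hj hjY
      exact hgind i (Finset.mem_sdiff.2 ⟨hi, hiY⟩) j (Finset.mem_sdiff.2 ⟨hj, hjY⟩)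
    have hga' : ∀ i ∈ R, i ∉ Y → ¬ G.Adj a (g i) := by
      intro i hi hiY
      exact hga i (Finset.mem_sdiff.2 ⟨hi, hiY⟩)
    rcases Finset.mem_union.1 ha with haA | haU
    · refine Or.inl ⟨a, haA, fun i => if i ∈ Y then f i else g i, ?_, ?_, ?_⟩
      · intro i hi
        by_cases h : i ∈ Y
        · simpa [h] using hf i hi
        · simpa [h] using (hg' i hi h).1
      · intro i hi j hj
        by_cases h : i ∈ Y <;> by_cases h' : j ∈ Y <;> simp only [h, h', if_true, if_false]
        · exact hind i hi j hj
        · exact (hg' j hj h').2.2 i h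
        · exact fun hh => (hg' i hi h).2.2 j h' hh.symm
        · exact hgind' i hi h j hj h'
      · intro i hi
        by_cases h : i ∈ Y <;> simp only [h, if_true, if_false]
        · exact fun hh => haY i h hh.symm
        · exact hga' i hi h
    · obtain ⟨k, hkY, hak⟩ := Finset.mem_biUnion.1 haU
      -- The vertex found lies in a blocking class `k`. It replaces `f k` and is not adjacent to
      -- `x`, so `x` has fewer blockers.
      let f' : ι → V := fun i => if i = k then a else if i ∈ Y then f i else g i
      have hlt : (R.filter (fun i => G.Adj x (f' i))).card < m := by
        rw [← hm]
        refine Finset.card_lt_card (Finset.ssubset_iff_of_subset ?_ |>.2 ⟨k, hkY, ?_⟩)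
        · intro i hi
          obtain ⟨hi, h⟩ := Finset.mem_filter.1 hi
          by_contra hiY
          by_cases hik : i = k
          · exact hiY (hik ▸ hkY)
          · simp only [f', hik, hiY, if_false] at h
            exact (hg' i hi hiY).2.1 h
        · simp only [Finset.mem_filter, not_and, f', if_true]
          exact fun _ => hax
      refine ihm _ hlt f' rfl ?_ ?_
      · intro i hi
        by_cases hik : i = k
        · simpa [f', hik] using hak
        by_cases h : i ∈ Y
        · simpa [f', h, hik] using hf i hi
        · simpa [f', h, hik] using (hg' i hi h).1
      · intro i hi j hj
        by_cases hik : i = k <;> by_cases hjk : j = k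
        · simp [f', hik, hjk]
        · simp only [f', hik, hjk, if_true, if_false]
          by_cases h' : j ∈ Y <;> simp only [h', if_true, if_false]
          · exact fun hh => haY j h' hh.symm
          · exact hga' j hj h'
        · simp only [f', hik, hjk, if_true, if_false]
          by_cases h' : i ∈ Y <;> simp only [h', if_true, if_false]
          · exact fun hh => haY i h' hh
          · exact fun hh => hga' i hi h' hh.symm
        · simp only [f', hik, hjk, if_false]
          by_cases h : i ∈ Y <;> by_cases h' : j ∈ Y <;> simp only [h, h', if_true, if_false]
          · exact hind i hi j hj
          · exact (hg' j hj h').2.2 i h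
          · exact fun hh => (hg' i hi h).2.2 j h' hh.symm
          · exact hgind' i hi h j hj h'
  · have hSY : Disjoint Y S := by
      rw [Finset.disjoint_left]
      intro i hi hiS
      exact (Finset.mem_sdiff.1 (hS hiS)).2 hi
    have hnot : ∀ i ∈ S, i ∉ Y := fun i hiS hi => Finset.disjoint_left.1 hSY hi hiS
    -- Every vertex discarded by `ok` is dominated by `x` or by a representative of `Y`. Adding `x`
    -- costs one element of `X`, paid for by `Y` being non-empty.
    refine Or.inr ⟨Y ∪ S, Finset.union_subset hYR fun i hi => (Finset.mem_sdiff.1 (hS hi)).1,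
      fun i => if i ∈ Y then f i else g i, insert x X, ?_, ?_, ?_, ?_⟩
    · intro i hi
      by_cases h : i ∈ Y
      · simpa [h] using hf i (hYR h)
      · have := hg i ((Finset.mem_union.1 hi).resolve_left h)
        simpa [h] using (Finset.mem_filter.1 this).1
    · rw [Finset.card_union_of_disjoint hSY]
      have := Finset.card_insert_le x X
      omega
    · intro z hz
      rcases Finset.mem_insert.1 hz with rfl | hz
      · exact Or.inl hx
      rcases hXm z hz with h | ⟨i, hi, h⟩
      · rcases Finset.mem_union.1 (Finset.mem_filter.1 h).1 with h | h
        · exact Or.inl h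
        · obtain ⟨k, hk, h⟩ := Finset.mem_biUnion.1 h
          exact Or.inr ⟨k, Finset.mem_union_left _ hk, h⟩
      · exact Or.inr ⟨i, Finset.mem_union_right _ hi, (Finset.mem_filter.1 h).1⟩
    · intro v hv
      by_cases hok : ok v
      · have : v ∈ A' ∨ ∃ i ∈ S, v ∈ U' i := by
          rcases hv with hv | ⟨i, hi, hv⟩
          · exact Or.inl (Finset.mem_filter.2 ⟨Finset.mem_union_left _ hv, hok⟩)
          · rcases Finset.mem_union.1 hi with h | h
            · exact Or.inl (Finset.mem_filter.2
                ⟨Finset.mem_union_right _ (Finset.mem_biUnion.2 ⟨i, h, hv⟩), hok⟩)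
            · exact Or.inr ⟨i, h, Finset.mem_filter.2 ⟨hv, hok⟩⟩
        obtain ⟨z, hz, hadj⟩ := hdom v this
        refine ⟨z, ?_, hadj⟩
        rcases hz with hz | ⟨i, hi, rfl⟩
        · exact Or.inl (Finset.mem_insert_of_mem hz)
        · exact Or.inr ⟨i, Finset.mem_union_right _ hi, by simp [hnot i hi]⟩
      · by_cases hxv : G.Adj x v
        · exact ⟨x, Or.inl (Finset.mem_insert_self _ _), hxv⟩
        · have : ∃ i ∈ Y, G.Adj (f i) v := by
            by_contra hcon
            push Not at hcon
            exact hok ⟨hxv, hcon⟩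
          obtain ⟨i, hi, h⟩ := this
          exact ⟨f i, Or.inr ⟨i, Finset.mem_union_left _ hi, by simp [hi]⟩, h⟩

/-- A lopsided independent transversal theorem for a family of disjoint finite sets. -/
theorem exists_independent_hitting_family {V : Type*} [Fintype V] [DecidableEq V]
    (G : SimpleGraph V) (o : Finset V → V → Finset V) (𝒱 : Finset (Finset V))
    (hne : ∀ A ∈ 𝒱, A.Nonempty) (hdisj : ∀ A ∈ 𝒱, ∀ B ∈ 𝒱, A ≠ B → Disjoint A B)
    (ho : ∀ A ∈ 𝒱, ∀ v ∈ A, ∀ B ∈ 𝒱, B ≠ A → ∀ w ∈ B, G.Adj v w → w ∈ o A v)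
    (ho2 : ∀ A ∈ 𝒱, ∀ v ∈ A, (o A v).card ≤ 2)
    (hoA : ∀ A ∈ 𝒱, ∀ v ∈ A, (o A v).card + 2 ≤ A.card) :
    ∃ I : Finset V, (∀ x ∈ I, ∀ y ∈ I, ¬ G.Adj x y) ∧ ∀ A ∈ 𝒱, ∃ v ∈ A, v ∈ I := by
  classical
  by_cases hV : Nonempty V
  swap
  · refine ⟨∅, by simp, fun A hA => ?_⟩
    exact (hV ⟨(hne A hA).choose⟩).elim
  suffices H : ∀ R ⊆ 𝒱, ∃ f : Finset V → V, (∀ A ∈ R, f A ∈ A) ∧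
      ∀ A ∈ R, ∀ B ∈ R, ¬ G.Adj (f A) (f B) by
    obtain ⟨f, h1, h2⟩ := H 𝒱 subset_rfl
    refine ⟨𝒱.image f, ?_, fun A hA => ⟨f A, h1 A hA, Finset.mem_image_of_mem f hA⟩⟩
    intro x hx y hy
    obtain ⟨A, hA, rfl⟩ := Finset.mem_image.1 hx
    obtain ⟨B, hB, rfl⟩ := Finset.mem_image.1 hy
    exact h2 A hA B hB
  -- Edges inside a class are irrelevant to a transversal and are not counted by `o`, so they are
  -- deleted.
  let G' : SimpleGraph V :=
    { Adj := fun v w => G.Adj v w ∧ ∀ A ∈ 𝒱, v ∈ A → w ∉ A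
      symm := ⟨fun v w h => ⟨h.1.symm, fun A hA hw hv => h.2 A hA hv hw⟩⟩
      loopless := ⟨fun v h => G.loopless.irrefl v h.1⟩ }
  intro R
  induction R using Finset.induction_on with
  | empty =>
    intro _
    exact ⟨fun _ => hV.some, by simp, by simp⟩
  | insert A R hAR ih =>
    intro hsub
    have hA : A ∈ 𝒱 := hsub (Finset.mem_insert_self _ _)
    have hR : R ⊆ 𝒱 := fun B hB => hsub (Finset.mem_insert_of_mem hB)
    obtain ⟨f, hf, hind⟩ := ih hR
    rcases transversal_or_dominated G' R.card id A R rfl f hf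
      (fun B hB C hC h => hind B hB C hC h.1) with
      ⟨a, ha, g, hg, hgind, hga⟩ | ⟨S, hS, g, X, hg, hX, hXm, hdom⟩
    · have cross : ∀ B ∈ 𝒱, ∀ C ∈ 𝒱, B ≠ C → ∀ b ∈ B, ∀ c ∈ C, G.Adj b c → G'.Adj b c := by
        intro B hB C hC hBC b hb c hc h
        refine ⟨h, fun D hD hbD hcD => ?_⟩
        have h1 : D = B := by
          by_contra hne
          exact Finset.disjoint_left.1 (hdisj D hD B hB hne) hbD hb
        have h2 : D = C := by
          by_contra hne
          exact Finset.disjoint_left.1 (hdisj D hD C hC hne) hcD hc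
        exact hBC (h1.symm.trans h2)
      have hneA : ∀ B ∈ R, B ≠ A := fun B hB h => hAR (h ▸ hB)
      refine ⟨fun B => if B = A then a else g B, ?_, ?_⟩
      · intro B hB
        by_cases h : B = A
        · simpa [h] using ha
        · simpa [h] using hg B ((Finset.mem_insert.1 hB).resolve_left h)
      · intro B hB C hC
        by_cases h : B = A <;> by_cases h' : C = A <;> simp only [h, h', if_true, if_false]
        · exact G.loopless.irrefl a
        · have hC := (Finset.mem_insert.1 hC).resolve_left h'
          exact fun hh => hga C hC (cross A hA C (hR hC) (hneA C hC).symm a ha _ (hg C hC) hh)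
        · have hB := (Finset.mem_insert.1 hB).resolve_left h
          exact fun hh =>
            hga B hB (cross A hA B (hR hB) (hneA B hB).symm a ha _ (hg B hB) hh.symm)
        · have hB := (Finset.mem_insert.1 hB).resolve_left h
          have hC := (Finset.mem_insert.1 hC).resolve_left h'
          by_cases hBC : B = C
          · subst hBC; exact G.loopless.irrefl _
          · exact fun hh =>
              hgind B hB C hC (cross B (hR hB) C (hR hC) hBC _ (hg B hB) _ (hg C hC) hh)
    · exfalso
      have hS𝒱 : S ⊆ 𝒱 := hS.trans hR
      have hAS : A ∉ S := fun h => hAR (hS h)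
      let T := insert A S
      have hT : T ⊆ 𝒱 := Finset.insert_subset hA hS𝒱
      have memT : ∀ v, (v ∈ A ∨ ∃ i ∈ S, v ∈ id i) ↔ v ∈ T.biUnion id := by
        intro v; simp [T]
      -- neighbours in other classes of a vertex `z`
      let N : V → Finset V := fun z => (T.biUnion id).filter (G'.Adj z)
      have hN : ∀ B ∈ T, ∀ z ∈ B, N z ⊆ o B z := by
        intro B hB z hz w hw
        obtain ⟨hw, hadj⟩ := Finset.mem_filter.1 hw
        obtain ⟨C, hC, hwC⟩ := Finset.mem_biUnion.1 hw
        refine ho B (hT hB) z hz C (hT hC) ?_ w hwC hadj.1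
        rintro rfl
        exact hadj.2 C (hT hC) hz hwC
      have hcover : T.biUnion id ⊆ X.biUnion N ∪ S.biUnion (fun i => N (g i)) := by
        intro v hv
        obtain ⟨z, hz, hadj⟩ := hdom v ((memT v).2 hv)
        rcases hz with hz | ⟨i, hi, rfl⟩
        · exact Finset.mem_union_left _
            (Finset.mem_biUnion.2 ⟨z, hz, Finset.mem_filter.2 ⟨hv, hadj⟩⟩)
        · exact Finset.mem_union_right _
            (Finset.mem_biUnion.2 ⟨i, hi, Finset.mem_filter.2 ⟨hv, hadj⟩⟩)
      -- The count behind the contradiction: vertices of `X` dominate at most 2 each, hence 2|S| in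
      -- all, and each `g B` dominates at most |B| - 2. Together this is at most Σ |B| over `S`,
      -- which leaves the non-empty `A` uncovered.
      have c1 : (T.biUnion id).card = A.card + ∑ B ∈ S, B.card := by
        rw [Finset.card_biUnion, Finset.sum_insert hAS]
        · rfl
        · intro B hB C hC hBC
          exact hdisj B (hT hB) C (hT hC) hBC
      have c2 : (X.biUnion N).card ≤ S.card * 2 := by
        calc _ ≤ X.card * 2 := by
              refine Finset.card_biUnion_le_card_mul _ _ _ fun z hz => ?_
              obtain ⟨B, hB, hzB⟩ := Finset.mem_biUnion.1 ((memT z).1 (hXm z hz))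
              exact (Finset.card_le_card (hN B hB z hzB)).trans (ho2 B (hT hB) z hzB)
          _ ≤ _ := Nat.mul_le_mul_right _ hX
      have c3 : (S.biUnion (fun i => N (g i))).card + S.card * 2 ≤ ∑ B ∈ S, B.card := by
        have h1 : (S.biUnion (fun i => N (g i))).card ≤ ∑ B ∈ S, (N (g B)).card :=
          Finset.card_biUnion_le
        have h2 : ∑ B ∈ S, ((N (g B)).card + 2) ≤ ∑ B ∈ S, B.card := by
          refine Finset.sum_le_sum fun B hB => ?_
          have := Finset.card_le_card (hN B (Finset.mem_insert_of_mem hB) _ (hg B hB))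
          have h3 := hoA B (hS𝒱 hB) (g B) (hg B hB)
          omega
        rw [Finset.sum_add_distrib, Finset.sum_const, smul_eq_mul] at h2
        omega
      have c4 := (Finset.card_le_card hcover).trans (Finset.card_union_le _ _)
      have c5 : 0 < A.card := Finset.card_pos.2 (hne A hA)
      omega

/-! ### Neighbourhoods, and the core and reach of a meeting class. -/

/-- The neighbours of a vertex, as a finite set. -/
noncomputable def nbrs {V : Type*} [Fintype V] (G : SimpleGraph V) (v : V) : Finset V := by
  classical exact Finset.univ.filter (G.Adj v)

theorem mem_nbrs {V : Type*} [Fintype V] {G : SimpleGraph V} {v w : V} :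
    w ∈ nbrs G v ↔ G.Adj v w := by
  classical
  simp [nbrs]

/-- The relation of having a common element is transitive on the family. -/
def MeetsTrans {V : Type*} [DecidableEq V] (𝒬 : Finset (Finset V)) : Prop :=
  ∀ A ∈ 𝒬, ∀ B ∈ 𝒬, ∀ C ∈ 𝒬, (A ∩ B).Nonempty → (B ∩ C).Nonempty → (A ∩ C).Nonempty

/-- The intersection of all members of the family that meet `A`. -/
noncomputable def core {V : Type*} [Fintype V] [DecidableEq V] (𝒬 : Finset (Finset V))
    (A : Finset V) : Finset V := by
  classical exact Finset.univ.filter (fun v => ∀ B ∈ 𝒬, (A ∩ B).Nonempty → v ∈ B)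

/-- The union of all members of the family that meet `A`. -/
noncomputable def reach {V : Type*} [Fintype V] [DecidableEq V] (𝒬 : Finset (Finset V))
    (A : Finset V) : Finset V := by
  classical exact Finset.univ.filter (fun v => ∃ B ∈ 𝒬, (A ∩ B).Nonempty ∧ v ∈ B)

section families

variable {V : Type*} [Fintype V] [DecidableEq V] {𝒬 : Finset (Finset V)} {A B : Finset V} {v : V}

theorem mem_core : v ∈ core 𝒬 A ↔ ∀ B ∈ 𝒬, (A ∩ B).Nonempty → v ∈ B := by
  simp [core]

theorem mem_reach : v ∈ reach 𝒬 A ↔ ∃ B ∈ 𝒬, (A ∩ B).Nonempty ∧ v ∈ B := by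
  simp [reach]

theorem core_subset (hA : A ∈ 𝒬) (hne : A.Nonempty) : core 𝒬 A ⊆ A := fun v hv =>
  mem_core.1 hv A hA (by simpa using hne)

theorem core_eq_of_meets (h : MeetsTrans 𝒬) (hA : A ∈ 𝒬) (hB : B ∈ 𝒬) (hAB : (A ∩ B).Nonempty) :
    core 𝒬 A = core 𝒬 B := by
  ext v
  rw [mem_core, mem_core]
  constructor
  · intro hv C hC hBC
    exact hv C hC (h A hA B hB C hC hAB hBC)
  · intro hv C hC hAC
    exact hv C hC (h B hB A hA C hC (by rwa [Finset.inter_comm]) hAC)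

/-- A common vertex would link `A` to `B` through one further member, and meeting members have equal
cores. Thus neighbours of a core vertex in another core are neighbours outside its own reach. -/
theorem disjoint_reach_core (h : MeetsTrans 𝒬) (hne : ∀ A ∈ 𝒬, A.Nonempty)
    (hA : A ∈ 𝒬) (hB : B ∈ 𝒬) (hAB : core 𝒬 A ≠ core 𝒬 B) :
    Disjoint (reach 𝒬 A) (core 𝒬 B) := by
  rw [Finset.disjoint_left]
  intro v hv hv'
  obtain ⟨C, hC, hAC, hvC⟩ := mem_reach.1 hv
  have hvB := core_subset hB (hne B hB) hv'
  exact hAB (core_eq_of_meets h hA hB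
    (h A hA C hC B hB hAC ⟨v, Finset.mem_inter.2 ⟨hvC, hvB⟩⟩))

theorem core_subset_reach (hA : A ∈ 𝒬) (hne : A.Nonempty) : core 𝒬 A ⊆ reach 𝒬 A := fun _ hv =>
  mem_reach.2 ⟨A, hA, by simpa using hne, core_subset hA hne hv⟩

end families

/-! ### Clique systems and their independent hitting sets. -/

/-- A family of `q`-cliques in a graph of maximum degree at most `q + 1`, with two exclusions that
hold for all `q`-cliques of a graph without `(q + 1)`-clique. -/
structure CliqueSystem {V : Type*} [Fintype V] [DecidableEq V] (G : SimpleGraph V) (q : ℕ)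
    (𝒬 : Finset (Finset V)) : Prop where
  card_nbrs_le : ∀ v, (nbrs G v).card ≤ q + 1
  clique : ∀ A ∈ 𝒬, G.IsNClique q A
  pair : ∀ A ∈ 𝒬, ∀ B ∈ 𝒬, (A ∩ B).card + 1 = q → ¬ G.IsClique (↑(A ∪ B) : Set V)
  triple : ∀ A ∈ 𝒬, ∀ B ∈ 𝒬, ∀ C ∈ 𝒬, (A ∩ B).card + 2 = q → (A ∩ C).card + 2 = q →
    (B ∩ C).card + 2 = q → (A ∩ B ∩ C).card + 4 ≠ q

section cliques

variable {V : Type*} [Fintype V] [DecidableEq V] {G : SimpleGraph V} {q : ℕ}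
  {𝒬 : Finset (Finset V)}

theorem card_insert_nbrs (v : V) : (insert v (nbrs G v)).card = (nbrs G v).card + 1 :=
  Finset.card_insert_of_notMem (by simp [mem_nbrs])

theorem clique_subset_insert_nbrs {A : Finset V} (hA : G.IsClique (A : Set V)) {v : V}
    (hv : v ∈ A) : A ⊆ insert v (nbrs G v) := by
  intro w hw
  by_cases h : w = v
  · simp [h]
  · exact Finset.mem_insert_of_mem (mem_nbrs.2 (hA hv hw (Ne.symm h)))

/-- The only vertex of `A` missing from `B` is `a`, so the union is `B` with `a` added, and `a` is
adjacent to all of `B`. -/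
theorem isClique_union_of_card_inter {A B : Finset V} {a : V} (hA : A.card = q)
    (hB : G.IsClique (B : Set V)) (haA : a ∈ A) (haB : a ∉ B) (hadj : B ⊆ insert a (nbrs G a))
    (hAB : (A ∩ B).card + 1 = q) : G.IsClique (↑(A ∪ B) : Set V) := by
  have hsub : A ∪ B ⊆ insert a B := by
    intro x hx
    by_contra hxn
    rw [Finset.mem_insert, not_or] at hxn
    have hxA : x ∈ A := (Finset.mem_union.1 hx).resolve_right hxn.2
    have h1 : insert x (insert a (A ∩ B)) ⊆ A := by
      intro y hy
      simp only [Finset.mem_insert, Finset.mem_inter] at hy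
      rcases hy with rfl | rfl | h
      exacts [hxA, haA, h.1]
    have h2 := Finset.card_le_card h1
    rw [Finset.card_insert_of_notMem, Finset.card_insert_of_notMem] at h2
    · omega
    · simp [haB]
    · simp [hxn.1, hxn.2]
  have h3 : G.IsClique (↑(insert a B) : Set V) := by
    rw [Finset.coe_insert, SimpleGraph.isClique_insert]
    refine ⟨hB, fun b hb hab => ?_⟩
    exact mem_nbrs.1 ((Finset.mem_insert.1 (hadj hb)).resolve_left (Ne.symm hab))
  exact h3.subset (by exact_mod_cast hsub)

theorem CliqueSystem.card_union_le (h : CliqueSystem G q 𝒬) {A B : Finset V} (hA : A ∈ 𝒬)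
    (hB : B ∈ 𝒬) (hAB : (A ∩ B).Nonempty) : (A ∪ B).card ≤ q + 2 := by
  obtain ⟨v, hv⟩ := hAB
  rw [Finset.mem_inter] at hv
  have := Finset.card_le_card (Finset.union_subset
    (clique_subset_insert_nbrs (h.clique A hA).1 hv.1)
    (clique_subset_insert_nbrs (h.clique B hB).1 hv.2))
  rw [card_insert_nbrs] at this
  have := h.card_nbrs_le v
  omega

theorem CliqueSystem.le_card_inter (h : CliqueSystem G q 𝒬) {A B : Finset V} (hA : A ∈ 𝒬)
    (hB : B ∈ 𝒬) (hAB : (A ∩ B).Nonempty) : q ≤ (A ∩ B).card + 2 := by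
  have h1 := h.card_union_le hA hB hAB
  have h2 := Finset.card_union_add_card_inter A B
  have := (h.clique A hA).2
  have := (h.clique B hB).2
  omega

/-- The closed neighbourhood of `v` has at most q + 2 vertices and contains `A ∪ B`; a larger union
leaves fewer neighbours outside. -/
theorem CliqueSystem.card_nbrs_sdiff_le (h : CliqueSystem G q 𝒬) {A B F : Finset V} (hA : A ∈ 𝒬)
    (hB : B ∈ 𝒬) {v : V} (hvA : v ∈ A) (hvB : v ∈ B) (hF : A ∪ B ⊆ F) :
    (nbrs G v \ F).card + (A ∪ B).card ≤ q + 2 := by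
  have hsub := Finset.union_subset
    (clique_subset_insert_nbrs (h.clique A hA).1 hvA)
    (clique_subset_insert_nbrs (h.clique B hB).1 hvB)
  have hdis : Disjoint (nbrs G v \ F) (A ∪ B) :=
    Finset.disjoint_left.2 fun x hx hx' => (Finset.mem_sdiff.1 hx).2 (hF hx')
  rw [← Finset.card_union_of_disjoint hdis]
  have h1 : nbrs G v \ F ∪ (A ∪ B) ⊆ insert v (nbrs G v) :=
    Finset.union_subset (Finset.sdiff_subset.trans (Finset.subset_insert _ _)) hsub
  have h2 := Finset.card_le_card h1
  rw [card_insert_nbrs] at h2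
  have := h.card_nbrs_le v
  omega

/-- Two cliques whose union is as large as the degree bound permits intersect in the core. -/
theorem CliqueSystem.inter_subset (h : CliqueSystem G q 𝒬) (hq : 4 ≤ q) {A B C : Finset V}
    (hA : A ∈ 𝒬) (hB : B ∈ 𝒬) (hC : C ∈ 𝒬) (hAB : (A ∩ B).card + 2 = q)
    (hAC : (A ∩ C).Nonempty) (hBC : (B ∩ C).Nonempty) : A ∩ B ⊆ C := by
  intro a ha
  by_contra haC
  have cA := (h.clique A hA).2
  have cB := (h.clique B hB).2
  have cC := (h.clique C hC).2
  have hU := Finset.card_union_add_card_inter A B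
  -- The union has q + 2 vertices, the maximum size of a closed neighbourhood.
  have full : ∀ b ∈ A ∩ B, A ∪ B = insert b (nbrs G b) := by
    intro b hb
    rw [Finset.mem_inter] at hb
    refine Finset.eq_of_subset_of_card_le (Finset.union_subset
      (clique_subset_insert_nbrs (h.clique A hA).1 hb.1)
      (clique_subset_insert_nbrs (h.clique B hB).1 hb.2)) ?_
    rw [card_insert_nbrs]
    have := h.card_nbrs_le b
    omega
  have hACc := h.le_card_inter hA hC hAC
  have hBCc := h.le_card_inter hB hC hBC
  have hincl : (C ∩ (A ∪ B)).card + (A ∩ B ∩ C).card = (A ∩ C).card + (B ∩ C).card := by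
    have := Finset.card_union_add_card_inter (A ∩ C) (B ∩ C)
    rw [← Finset.union_inter_distrib_right] at this
    rw [← this, Finset.inter_comm C]
    congr 2
    ext x
    simp only [Finset.mem_inter]
    tauto
  -- With a vertex common to all three, `full` confines `C`. Without one, `C` has at least 2(q - 2)
  -- ≥ q vertices in the union; this uses q ≥ 4.
  have hCsub : C ⊆ A ∪ B := by
    by_cases hS : (A ∩ B ∩ C).Nonempty
    · obtain ⟨b, hb⟩ := hS
      rw [Finset.mem_inter] at hb
      rw [full b hb.1]
      exact clique_subset_insert_nbrs (h.clique C hC).1 hb.2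
    · rw [Finset.not_nonempty_iff_eq_empty] at hS
      rw [hS, Finset.card_empty] at hincl
      have : C ∩ (A ∪ B) = C :=
        Finset.eq_of_subset_of_card_le Finset.inter_subset_left (by omega)
      exact Finset.inter_eq_left.1 this
  rw [Finset.inter_eq_left.2 hCsub] at hincl
  have hadj : C ⊆ insert a (nbrs G a) := full a ha ▸ hCsub
  rw [Finset.mem_inter] at ha
  -- Since `a` is adjacent to all of `C`, an overlap of q - 1 would make `D ∪ C` a clique, against
  -- `pair`. Both overlaps are thus q - 2, and counting `C` leaves the triple intersection q - 4,
  -- against `triple`.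
  have key : ∀ D ∈ 𝒬, a ∈ D → q ≤ (D ∩ C).card + 2 → (D ∩ C).card + 2 = q := by
    intro D hD haD hDC
    have cD := (h.clique D hD).2
    have h1 : (D ∩ C).card < D.card :=
      Finset.card_lt_card (Finset.ssubset_iff_of_subset Finset.inter_subset_left |>.2
        ⟨a, haD, by simp [haC]⟩)
    have h2 : (D ∩ C).card + 1 ≠ q := fun hh =>
      h.pair D hD C hC hh (isClique_union_of_card_inter cD (h.clique C hC).1 haD haC hadj hh)
    omega
  have k1 := key A hA ha.1 hACc
  have k2 := key B hB ha.2 hBCc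
  exact h.triple A hA B hB C hC hAB k1 k2 (by omega)

/-- These are the bounds required of a class in `exists_independent_hitting_family`. -/
theorem CliqueSystem.core_bounds (h : CliqueSystem G q 𝒬) (hq : 4 ≤ q) (ht : MeetsTrans 𝒬)
    {Q : Finset V} (hQ : Q ∈ 𝒬) :
    (core 𝒬 Q).Nonempty ∧ ∀ v ∈ core 𝒬 Q,
      (nbrs G v \ reach 𝒬 Q).card ≤ 2 ∧ (nbrs G v \ reach 𝒬 Q).card + 2 ≤ (core 𝒬 Q).card := by
  have hne : ∀ A ∈ 𝒬, A.Nonempty := fun A hA => Finset.card_pos.1 (by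
    rw [(h.clique A hA).2]; omega)
  have hsubr : ∀ A ∈ 𝒬, (Q ∩ A).Nonempty → A ⊆ reach 𝒬 Q := fun A hA hQA v hv =>
    mem_reach.2 ⟨A, hA, hQA, hv⟩
  have hmeet : ∀ A ∈ 𝒬, ∀ B ∈ 𝒬, (Q ∩ A).Nonempty → (Q ∩ B).Nonempty → (A ∩ B).Nonempty :=
    fun A hA B hB hQA hQB => ht A hA Q hQ B hB (by rwa [Finset.inter_comm]) hQB
  -- With u = |A ∪ B| ≤ q + 2, the core has at least 2q - u ≥ q - 2 vertices, and a core vertex has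
  -- at most q + 2 - u ≤ 2 neighbours outside. The gap of 2 between these is q ≥ 4.
  suffices H : ∃ A ∈ 𝒬, ∃ B ∈ 𝒬, (Q ∩ A).Nonempty ∧ (Q ∩ B).Nonempty ∧ A ∩ B ⊆ core 𝒬 Q by
    obtain ⟨A, hA, B, hB, hQA, hQB, hsub⟩ := H
    have hAB := hmeet A hA B hB hQA hQB
    have c1 := Finset.card_le_card hsub
    have c2 := Finset.card_union_add_card_inter A B
    have c3 := h.card_union_le hA hB hAB
    have cA := (h.clique A hA).2
    have cB := (h.clique B hB).2
    have c4 : A.card ≤ (A ∪ B).card := Finset.card_le_card Finset.subset_union_left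
    refine ⟨Finset.card_pos.1 (by omega), fun v hv => ?_⟩
    rw [mem_core] at hv
    have := h.card_nbrs_sdiff_le hA hB (hv A hA hQA) (hv B hB hQB)
      (Finset.union_subset (hsubr A hA hQA) (hsubr B hB hQB))
    omega
  by_cases hcase : ∃ A ∈ 𝒬, ∃ B ∈ 𝒬, (Q ∩ A).Nonempty ∧ (Q ∩ B).Nonempty ∧ (A ∩ B).card + 2 = q
  · obtain ⟨A, hA, B, hB, hQA, hQB, hAB⟩ := hcase
    refine ⟨A, hA, B, hB, hQA, hQB, fun a ha => mem_core.2 fun C hC hQC => ?_⟩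
    exact h.inter_subset hq hA hB hC hAB (hmeet A hA C hC hQA hQC) (hmeet B hB C hC hQB hQC) ha
  · push Not at hcase
    have hQQ : (Q ∩ Q).Nonempty := by simpa using hne Q hQ
    have hbig : ∀ A ∈ 𝒬, ∀ B ∈ 𝒬, (Q ∩ A).Nonempty → (Q ∩ B).Nonempty → A ≠ B →
        (A ∩ B).card + 1 = q := by
      intro A hA B hB hQA hQB hAB
      have c1 := h.le_card_inter hA hB (hmeet A hA B hB hQA hQB)
      have c2 := hcase A hA B hB hQA hQB
      have cA := (h.clique A hA).2
      have cB := (h.clique B hB).2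
      have c3 : (A ∩ B).card < A.card := by
        refine Finset.card_lt_card (Finset.ssubset_iff_subset_ne.2
          ⟨Finset.inter_subset_left, fun hh => hAB ?_⟩)
        exact Finset.eq_of_subset_of_card_le (Finset.inter_eq_left.1 hh) (by omega)
      omega
    by_cases hone : ∃ A ∈ 𝒬, (Q ∩ A).Nonempty ∧ A ≠ Q
    · obtain ⟨A, hA, hQA, hAQ⟩ := hone
      refine ⟨A, hA, Q, hQ, hQA, hQQ, fun a ha => mem_core.2 fun C hC hQC => ?_⟩
      by_contra haC
      rw [Finset.mem_inter] at ha
      -- All overlaps in the class are now q - 1. A member `C` missing `a` places both `A` and `Q`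
      -- inside `C` plus `a`, so their union would be a clique.
      have sub : ∀ D ∈ 𝒬, (Q ∩ D).Nonempty → a ∈ D → D ⊆ insert a C := by
        intro D hD hQD haD x hxD
        by_contra hx
        rw [Finset.mem_insert, not_or] at hx
        have hDC := hbig D hD C hC hQD hQC (fun hh => haC (hh ▸ haD))
        have h1 : insert x (insert a (D ∩ C)) ⊆ D := by
          intro y hy
          simp only [Finset.mem_insert, Finset.mem_inter] at hy
          rcases hy with rfl | rfl | h
          exacts [hxD, haD, h.1]
        have h2 := Finset.card_le_card h1
        rw [Finset.card_insert_of_notMem, Finset.card_insert_of_notMem] at h2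
        · have := (h.clique D hD).2
          omega
        · simp [haC]
        · simp [hx.1, hx.2]
      refine h.pair A hA Q hQ (hbig A hA Q hQ hQA hQQ hAQ) ?_
      intro x hx y hy hxy
      have hx' := Finset.union_subset (sub A hA hQA ha.1) (sub Q hQ hQQ ha.2) hx
      have hy' := Finset.union_subset (sub A hA hQA ha.1) (sub Q hQ hQQ ha.2) hy
      have adj_a : ∀ z ∈ A ∪ Q, z ≠ a → G.Adj a z := by
        intro z hz hza
        rcases Finset.mem_union.1 hz with hz | hz
        · exact (h.clique A hA).1 ha.1 hz hza.symm
        · exact (h.clique Q hQ).1 ha.2 hz hza.symm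
      by_cases hxa : x = a
      · exact hxa ▸ adj_a y hy (hxa ▸ hxy.symm)
      by_cases hya : y = a
      · exact hya ▸ (adj_a x hx hxa).symm
      exact (h.clique C hC).1 ((Finset.mem_insert.1 hx').resolve_left hxa)
        ((Finset.mem_insert.1 hy').resolve_left hya) hxy
    · push Not at hone
      refine ⟨Q, hQ, Q, hQ, hQQ, hQQ, fun a ha => mem_core.2 fun C hC hQC => ?_⟩
      rw [hone C hC hQC]
      simpa using ha

/-- In a clique system in which meeting is transitive, some independent set hits all cliques, and
all members of a further family of disjoint sets with few edges to the outside. -/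
theorem CliqueSystem.exists_hitting (h : CliqueSystem G q 𝒬) (hq : 4 ≤ q) (ht : MeetsTrans 𝒬)
    (𝒲 : Finset (Finset V)) (hW3 : ∀ A ∈ 𝒲, 3 ≤ A.card)
    (hWd : ∀ A ∈ 𝒲, ∀ B ∈ 𝒲, A ≠ B → Disjoint A B)
    (hWQ : ∀ A ∈ 𝒲, ∀ B ∈ 𝒬, Disjoint A B)
    (o : Finset V → V → Finset V) (ho1 : ∀ A ∈ 𝒲, ∀ v ∈ A, (o A v).card ≤ 1)
    (hoW : ∀ A ∈ 𝒲, ∀ v ∈ A, ∀ B ∈ 𝒲, B ≠ A → ∀ w ∈ B, G.Adj v w → w ∈ o A v)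
    (hoQ : ∀ A ∈ 𝒲, ∀ v ∈ A, ∀ B ∈ 𝒬, ∀ w ∈ B, G.Adj v w → w ∈ o A v) :
    ∃ I : Finset V, (∀ x ∈ I, ∀ y ∈ I, ¬ G.Adj x y) ∧ (∀ A ∈ 𝒬, ∃ v ∈ A, v ∈ I) ∧
      ∀ A ∈ 𝒲, ∃ v ∈ A, v ∈ I := by
  classical
  have hne : ∀ A ∈ 𝒬, A.Nonempty := fun A hA => Finset.card_pos.1 (by
    rw [(h.clique A hA).2]; omega)
  have hWne : ∀ A ∈ 𝒲, A.Nonempty := fun A hA => Finset.card_pos.1 (by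
    have := hW3 A hA; omega)
  have hrW : ∀ Q ∈ 𝒬, ∀ A ∈ 𝒲, Disjoint (reach 𝒬 Q) A := by
    intro Q _ A hA
    rw [Finset.disjoint_left]
    intro v hv hvA
    obtain ⟨B, hB, _, hvB⟩ := mem_reach.1 hv
    exact Finset.disjoint_left.1 (hWQ A hA B hB) hvA hvB
  have hcW : ∀ Q ∈ 𝒬, ∀ A ∈ 𝒲, Disjoint (core 𝒬 Q) A := fun Q hQ A hA =>
    Finset.disjoint_of_subset_left (core_subset_reach hQ (hne Q hQ)) (hrW Q hQ A hA)
  have hnot : ∀ A ∈ 𝒲, ∀ Q ∈ 𝒬, core 𝒬 Q ≠ A := by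
    intro A hA Q hQ hh
    obtain ⟨v, hv⟩ := hWne A hA
    exact Finset.disjoint_left.1 (hcW Q hQ A hA) (hh ▸ hv) hv
  -- A core may come from several cliques; one is chosen. The value `∅` is never reached on the
  -- family in use.
  let o' : Finset V → V → Finset V := fun A v =>
    if A ∈ 𝒲 then o A v else
      if hA : ∃ Q ∈ 𝒬, core 𝒬 Q = A then nbrs G v \ reach 𝒬 hA.choose else ∅
  have ho'W : ∀ A ∈ 𝒲, ∀ v, o' A v = o A v := fun A hA v => by simp only [o', hA, if_true]
  have ho'Q : ∀ A ∈ 𝒬.image (core 𝒬), ∃ Q ∈ 𝒬, core 𝒬 Q = A ∧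
      ∀ v, o' A v = nbrs G v \ reach 𝒬 Q := by
    intro A hA
    obtain ⟨Q, hQ, hQA⟩ := Finset.mem_image.1 hA
    have hex : ∃ Q ∈ 𝒬, core 𝒬 Q = A := ⟨Q, hQ, hQA⟩
    have hAW : A ∉ 𝒲 := fun hAW => hnot A hAW Q hQ hQA
    refine ⟨hex.choose, hex.choose_spec.1, hex.choose_spec.2, fun v => ?_⟩
    simp only [o', hAW, if_false, hex, dif_pos]
  obtain ⟨I, hI, hhit⟩ := exists_independent_hitting_family G o' (𝒬.image (core 𝒬) ∪ 𝒲)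
    (by
      intro A hA
      rcases Finset.mem_union.1 hA with hA | hA
      · obtain ⟨Q, hQ, rfl⟩ := Finset.mem_image.1 hA
        exact (h.core_bounds hq ht hQ).1
      · exact hWne A hA)
    (by
      intro A hA B hB hAB
      rcases Finset.mem_union.1 hA with hA | hA <;> rcases Finset.mem_union.1 hB with hB | hB
      · obtain ⟨Q, hQ, rfl⟩ := Finset.mem_image.1 hA
        obtain ⟨Q', hQ', rfl⟩ := Finset.mem_image.1 hB
        exact Finset.disjoint_of_subset_left (core_subset_reach hQ (hne Q hQ))
          (disjoint_reach_core ht hne hQ hQ' hAB)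
      · obtain ⟨Q, hQ, rfl⟩ := Finset.mem_image.1 hA
        exact hcW Q hQ B hB
      · obtain ⟨Q, hQ, rfl⟩ := Finset.mem_image.1 hB
        exact (hcW Q hQ A hA).symm
      · exact hWd A hA B hB hAB)
    (by
      intro A hA v hv B hB hBA w hw hvw
      rcases Finset.mem_union.1 hA with hA | hA
      · obtain ⟨Q, hQ, rfl, hoe⟩ := ho'Q A hA
        rw [hoe, Finset.mem_sdiff, mem_nbrs]
        refine ⟨hvw, fun hwr => ?_⟩
        rcases Finset.mem_union.1 hB with hB | hB
        · obtain ⟨Q', hQ', rfl⟩ := Finset.mem_image.1 hB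
          exact Finset.disjoint_left.1 (disjoint_reach_core ht hne hQ hQ' hBA.symm) hwr hw
        · exact Finset.disjoint_left.1 (hrW Q hQ B hB) hwr hw
      · rw [ho'W A hA]
        rcases Finset.mem_union.1 hB with hB | hB
        · obtain ⟨Q', hQ', rfl⟩ := Finset.mem_image.1 hB
          exact hoQ A hA v hv Q' hQ' w (core_subset hQ' (hne _ hQ') hw) hvw
        · exact hoW A hA v hv B hB hBA w hw hvw)
    (by
      intro A hA v hv
      rcases Finset.mem_union.1 hA with hA | hA
      · obtain ⟨Q, hQ, rfl, hoe⟩ := ho'Q A hA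
        rw [hoe]
        exact ((h.core_bounds hq ht hQ).2 v hv).1
      · rw [ho'W A hA]
        exact (ho1 A hA v hv).trans (by norm_num))
    (by
      intro A hA v hv
      rcases Finset.mem_union.1 hA with hA | hA
      · obtain ⟨Q, hQ, rfl, hoe⟩ := ho'Q A hA
        rw [hoe]
        exact ((h.core_bounds hq ht hQ).2 v hv).2
      · rw [ho'W A hA]
        have := ho1 A hA v hv
        have := hW3 A hA
        omega)
  refine ⟨I, hI, fun A hA => ?_, fun A hA => hhit A (Finset.mem_union_right _ hA)⟩
  obtain ⟨v, hv, hvI⟩ := hhit _ (Finset.mem_union_left _ (Finset.mem_image_of_mem (core 𝒬) hA))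
  exact ⟨v, core_subset hA (hne A hA) hv, hvI⟩

end cliques

/-! ### Chains of 4-cliques and their contraction. -/

/-- Every vertex of `P` lies in two members of `𝒬` inside `P` that share exactly two vertices. -/
def BlobClosed {V : Type*} [DecidableEq V] (𝒬 : Finset (Finset V)) (P : Finset V) : Prop :=
  ∀ v ∈ P, ∃ A ∈ 𝒬, ∃ B ∈ 𝒬, A ⊆ P ∧ B ⊆ P ∧ v ∈ A ∧ v ∈ B ∧ (A ∩ B).card = 2

/-- Three members of `𝒬` of which only the middle one meets both others. -/
structure CliqueChain {V : Type*} [DecidableEq V] (𝒬 : Finset (Finset V)) (A B C : Finset V) :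
    Prop where
  memA : A ∈ 𝒬
  memB : B ∈ 𝒬
  memC : C ∈ 𝒬
  meetAB : (A ∩ B).Nonempty
  meetBC : (B ∩ C).Nonempty
  disj : Disjoint A C

theorem CliqueChain.symm {V : Type*} [DecidableEq V] {𝒬 : Finset (Finset V)}
    {A B C : Finset V} (h : CliqueChain 𝒬 A B C) : CliqueChain 𝒬 C B A :=
  ⟨h.memC, h.memB, h.memA, by rw [Finset.inter_comm]; exact h.meetBC,
    by rw [Finset.inter_comm]; exact h.meetAB, h.disj.symm⟩

section chains

variable {V : Type*} [Fintype V] [DecidableEq V] {G : SimpleGraph V}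
  {𝒬 : Finset (Finset V)} {A B C : Finset V}

/-- Both overlaps have at least two vertices and are disjoint inside the four vertices of `B`, so
they split `B` into two pairs. -/
theorem CliqueChain.card_inter (h : CliqueChain 𝒬 A B C) (hs : CliqueSystem G 4 𝒬) :
    (A ∩ B).card = 2 ∧ (B ∩ C).card = 2 := by
  have h1 := hs.le_card_inter h.memA h.memB h.meetAB
  have h2 := hs.le_card_inter h.memB h.memC h.meetBC
  have h3 : Disjoint (A ∩ B) (B ∩ C) := Finset.disjoint_of_subset_left Finset.inter_subset_left
    (Finset.disjoint_of_subset_right Finset.inter_subset_right h.disj)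
  have h4 := Finset.card_le_card (Finset.union_subset
    (Finset.inter_subset_right : A ∩ B ⊆ B) (Finset.inter_subset_left : B ∩ C ⊆ B))
  rw [Finset.card_union_of_disjoint h3, (hs.clique B h.memB).2] at h4
  omega

theorem CliqueChain.mem_or_mem (h : CliqueChain 𝒬 A B C) (hs : CliqueSystem G 4 𝒬) {v : V}
    (hv : v ∈ B) : v ∈ A ∨ v ∈ C := by
  by_contra hcon
  rw [not_or] at hcon
  obtain ⟨h1, h2⟩ := h.card_inter hs
  have h3 : Disjoint (A ∩ B) (B ∩ C) := Finset.disjoint_of_subset_left Finset.inter_subset_left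
    (Finset.disjoint_of_subset_right Finset.inter_subset_right h.disj)
  have h4 : insert v (A ∩ B ∪ B ∩ C) ⊆ B := by
    intro x hx
    simp only [Finset.mem_insert, Finset.mem_union, Finset.mem_inter] at hx
    rcases hx with rfl | h | h
    exacts [hv, h.2, h.1]
  have h5 := Finset.card_le_card h4
  rw [Finset.card_insert_of_notMem (by simp [hcon.1, hcon.2]), Finset.card_union_of_disjoint h3,
    (hs.clique B h.memB).2] at h5
  omega

theorem CliqueChain.card_sdiff (h : CliqueChain 𝒬 A B C) (hs : CliqueSystem G 4 𝒬) :
    (A \ B).card = 2 := by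
  have h1 := Finset.card_sdiff_add_card_inter A B
  rw [(h.card_inter hs).1, (hs.clique A h.memA).2] at h1
  omega

/-- The six vertices of `A ∪ B` exhaust the closed neighbourhood under degree bound 5. -/
theorem CliqueChain.insert_nbrs (h : CliqueChain 𝒬 A B C) (hs : CliqueSystem G 4 𝒬) {v : V}
    (hA : v ∈ A) (hB : v ∈ B) : insert v (nbrs G v) = A ∪ B := by
  symm
  refine Finset.eq_of_subset_of_card_le (Finset.union_subset
    (clique_subset_insert_nbrs (hs.clique A h.memA).1 hA)
    (clique_subset_insert_nbrs (hs.clique B h.memB).1 hB)) ?_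
  have h1 := hs.card_nbrs_le v
  have h2 := Finset.card_union_add_card_inter A B
  rw [(h.card_inter hs).1, (hs.clique A h.memA).2, (hs.clique B h.memB).2] at h2
  rw [card_insert_nbrs]
  omega

theorem CliqueChain.mem_of_adj (h : CliqueChain 𝒬 A B C) (hs : CliqueSystem G 4 𝒬) {v w : V}
    (hA : v ∈ A) (hB : v ∈ B) (hvw : G.Adj v w) : w ∈ A ∨ w ∈ B := by
  rw [← Finset.mem_union, ← h.insert_nbrs hs hA hB]
  exact Finset.mem_insert_of_mem (mem_nbrs.2 hvw)

/-- Such a `Q` lies in `A ∪ B`. It cannot contain both a vertex of `A \ B` and one of `B \ A`: the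
latter lies in `C`, and all its neighbours are in `B ∪ C`. -/
theorem CliqueChain.eq_of_mem (h : CliqueChain 𝒬 A B C) (hs : CliqueSystem G 4 𝒬) {Q : Finset V}
    (hQ : Q ∈ 𝒬) {v : V} (hvA : v ∈ A) (hvB : v ∈ B) (hvQ : v ∈ Q) : Q = A ∨ Q = B := by
  have cQ := (hs.clique Q hQ).2
  have hsub : Q ⊆ A ∪ B := by
    rw [← h.insert_nbrs hs hvA hvB]
    exact clique_subset_insert_nbrs (hs.clique Q hQ).1 hvQ
  by_cases hQB : Q ⊆ B
  · exact Or.inr (Finset.eq_of_subset_of_card_le hQB (by rw [(hs.clique B h.memB).2, cQ]))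
  left
  refine Finset.eq_of_subset_of_card_le ?_ (by rw [(hs.clique A h.memA).2, cQ])
  obtain ⟨x, hxQ, hxB⟩ := Finset.not_subset.1 hQB
  have hxA : x ∈ A := (Finset.mem_union.1 (hsub hxQ)).resolve_right hxB
  intro y hy
  by_contra hyA
  have hyB := (Finset.mem_union.1 (hsub hy)).resolve_left hyA
  have hyC := (h.mem_or_mem hs hyB).resolve_left hyA
  have hyx : y ≠ x := fun hh => hxB (hh ▸ hyB)
  rcases h.symm.mem_of_adj hs hyC hyB ((hs.clique Q hQ).1 hy hxQ hyx) with hx | hx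
  · exact Finset.disjoint_left.1 h.disj hxA hx
  · exact hxB hx

theorem CliqueChain.eq_or_disjoint (h : CliqueChain 𝒬 A B C) (hs : CliqueSystem G 4 𝒬)
    {Q : Finset V} (hQ : Q ∈ 𝒬) : Q = A ∨ Q = B ∨ Q = C ∨ Disjoint Q B := by
  by_cases hd : Disjoint Q B
  · tauto
  obtain ⟨v, hvQ, hvB⟩ := Finset.not_disjoint_iff.1 hd
  rcases h.mem_or_mem hs hvB with hv | hv
  · have := h.eq_of_mem hs hQ hv hvB hvQ
    tauto
  · have := h.symm.eq_of_mem hs hQ hv hvB hvQ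
    tauto

theorem CliqueChain.inter_eq (h : CliqueChain 𝒬 A B C) (hs : CliqueSystem G 4 𝒬) {Q : Finset V}
    (hQ : Q ∈ 𝒬) (hQB : Disjoint Q B) {x : V} (hx : x ∈ A) (hxQ : x ∈ Q) : A ∩ Q = A \ B := by
  have h1 := hs.le_card_inter h.memA hQ ⟨x, Finset.mem_inter.2 ⟨hx, hxQ⟩⟩
  refine Finset.eq_of_subset_of_card_le ?_ (by rw [h.card_sdiff hs]; omega)
  intro y hy
  rw [Finset.mem_inter] at hy
  exact Finset.mem_sdiff.2 ⟨hy.1, fun hyB => Finset.disjoint_left.1 hQB hy.2 hyB⟩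

/-- A vertex of `B ∩ C` has all its neighbours in `B ∪ C`, which `I` avoids, so it can be added; it
hits `B` and `C`. Every remaining clique is `A` or is disjoint from `B`. -/
theorem CliqueChain.extend (h : CliqueChain 𝒬 A B C) (hs : CliqueSystem G 4 𝒬) {I : Finset V}
    (hI : ∀ x ∈ I, ∀ y ∈ I, ¬ G.Adj x y) (hIB : Disjoint I B) {x : V} (hx : x ∈ I) (hxA : x ∈ A)
    (hIC : Disjoint I C) (hhit : ∀ Q ∈ 𝒬, Disjoint Q B → ∃ v ∈ Q, v ∈ I) :
    ∃ J : Finset V, (∀ x ∈ J, ∀ y ∈ J, ¬ G.Adj x y) ∧ ∀ Q ∈ 𝒬, ∃ v ∈ Q, v ∈ J := by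
  obtain ⟨y, hy⟩ := h.meetBC
  rw [Finset.mem_inter] at hy
  have hyI : ∀ z ∈ I, ¬ G.Adj y z := by
    intro z hz hyz
    rcases h.symm.mem_of_adj hs hy.2 hy.1 hyz with hz' | hz'
    · exact Finset.disjoint_left.1 hIC hz hz'
    · exact Finset.disjoint_left.1 hIB hz hz'
  refine ⟨insert y I, ?_, ?_⟩
  · intro a ha b hb
    rcases Finset.mem_insert.1 ha with ha' | ha' <;> rcases Finset.mem_insert.1 hb with hb' | hb'
    · rw [ha', hb']; exact G.loopless.irrefl _
    · rw [ha']; exact hyI b hb'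
    · rw [hb']; exact fun hh => hyI a ha' hh.symm
    · exact hI a ha' b hb'
  · intro Q hQ
    rcases h.eq_or_disjoint hs hQ with rfl | rfl | rfl | hd
    · exact ⟨x, hxA, Finset.mem_insert_of_mem hx⟩
    · exact ⟨y, hy.1, Finset.mem_insert_self _ _⟩
    · exact ⟨y, hy.2, Finset.mem_insert_self _ _⟩
    · obtain ⟨v, hv, hvI⟩ := hhit Q hQ hd
      exact ⟨v, hv, Finset.mem_insert_of_mem hvI⟩

/-- The graph in which the edges at `B` are replaced by all edges between `A \ B` and `C \ B`. -/
def contractChain (G : SimpleGraph V) (A B C : Finset V) (hAC : Disjoint A C) : SimpleGraph V where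
  Adj x y := (G.Adj x y ∧ x ∉ B ∧ y ∉ B) ∨ (x ∈ A \ B ∧ y ∈ C \ B) ∨ (x ∈ C \ B ∧ y ∈ A \ B)
  symm := ⟨by
    rintro x y (⟨h1, h2, h3⟩ | h | h)
    · exact Or.inl ⟨h1.symm, h3, h2⟩
    · exact Or.inr (Or.inr ⟨h.2, h.1⟩)
    · exact Or.inr (Or.inl ⟨h.2, h.1⟩)⟩
  loopless := ⟨by
    rintro x (⟨h1, -⟩ | h | h)
    · exact G.loopless.irrefl x h1
    · exact Finset.disjoint_left.1 hAC (Finset.mem_sdiff.1 h.1).1 (Finset.mem_sdiff.1 h.2).1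
    · exact Finset.disjoint_left.1 hAC (Finset.mem_sdiff.1 h.2).1 (Finset.mem_sdiff.1 h.1).1⟩

/-- A vertex of `A \ B` loses the two neighbours in `A ∩ B` and gains the two vertices of `C \ B`.
-/
theorem CliqueChain.card_nbrs_contract_of_mem (h : CliqueChain 𝒬 A B C)
    (hs : CliqueSystem G 4 𝒬) {G' : SimpleGraph V} {v : V} (hv : v ∈ A \ B)
    (hG' : ∀ w, G'.Adj v w → (G.Adj v w ∧ w ∉ B) ∨ w ∈ C \ B) : (nbrs G' v).card ≤ 5 := by
  have hvA := (Finset.mem_sdiff.1 hv).1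
  have hvB := (Finset.mem_sdiff.1 hv).2
  have h1 : nbrs G' v ⊆ (nbrs G v \ (A ∩ B)) ∪ (C \ B) := by
    intro w hw
    rcases hG' w (mem_nbrs.1 hw) with hh | hh
    · refine Finset.mem_union_left _ (Finset.mem_sdiff.2 ⟨mem_nbrs.2 hh.1, fun hw => ?_⟩)
      exact hh.2 (Finset.mem_inter.1 hw).2
    · exact Finset.mem_union_right _ hh
  have h2 : A ∩ B ⊆ nbrs G v := by
    intro w hw
    rw [Finset.mem_inter] at hw
    exact mem_nbrs.2 ((hs.clique A h.memA).1 hvA hw.1 (fun hh => hvB (hh ▸ hw.2)))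
  have h3 := (Finset.card_le_card h1).trans (Finset.card_union_le _ _)
  rw [Finset.card_sdiff_of_subset h2, (h.card_inter hs).1, h.symm.card_sdiff hs] at h3
  have := hs.card_nbrs_le v
  omega

end chains

/-- For q = 4 a violation of `triple` is three 4-cliques with pairwise overlaps of two and no common
vertex. Each vertex of their union then lies in exactly two of them, so the union is closed. -/
theorem cliqueSystem_four {V : Type*} [Fintype V] [DecidableEq V] {G : SimpleGraph V}
    {𝒬 : Finset (Finset V)} (hdeg : ∀ v, (nbrs G v).card ≤ 5)
    (hcl : ∀ A ∈ 𝒬, G.IsNClique 4 A)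
    (hpair : ∀ A ∈ 𝒬, ∀ B ∈ 𝒬, (A ∩ B).card + 1 = 4 → ¬ G.IsClique (↑(A ∪ B) : Set V))
    (hblob : ∀ P : Finset V, P.Nonempty → ¬ BlobClosed 𝒬 P) : CliqueSystem G 4 𝒬 := by
  refine ⟨hdeg, hcl, hpair, ?_⟩
  intro A hA B hB C hC hAB hAC hBC h3
  have cover : ∀ X Y Z : Finset V, X.card = 4 → (X ∩ Y).card + 2 = 4 → (X ∩ Z).card + 2 = 4 →
      (X ∩ Y ∩ Z).card + 4 = 4 → ∀ v ∈ X, v ∈ Y ∨ v ∈ Z := by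
    intro X Y Z hX hXY hXZ hXYZ v hv
    have h1 : (X ∩ Y) ∪ (X ∩ Z) = X := by
      refine Finset.eq_of_subset_of_card_le
        (Finset.union_subset Finset.inter_subset_left Finset.inter_subset_left) ?_
      have h2 := Finset.card_union_add_card_inter (X ∩ Y) (X ∩ Z)
      have h4 : (X ∩ Y) ∩ (X ∩ Z) = X ∩ Y ∩ Z := by
        ext x; simp only [Finset.mem_inter]; tauto
      rw [h4] at h2
      omega
    rw [← h1] at hv
    simp only [Finset.mem_union, Finset.mem_inter] at hv
    tauto
  have cA := (hcl A hA).2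
  have cB := (hcl B hB).2
  have cC := (hcl C hC).2
  refine hblob (A ∪ B ∪ C) ?_ ?_
  · obtain ⟨v, hv⟩ := Finset.card_pos.1 (by rw [cA]; norm_num : 0 < A.card)
    exact ⟨v, Finset.mem_union_left _ (Finset.mem_union_left _ hv)⟩
  have sA : A ⊆ A ∪ B ∪ C := Finset.subset_union_left.trans Finset.subset_union_left
  have sB : B ⊆ A ∪ B ∪ C := Finset.subset_union_right.trans Finset.subset_union_left
  have sC : C ⊆ A ∪ B ∪ C := Finset.subset_union_right
  have two : ∀ v, (v ∈ A ∧ v ∈ B) ∨ (v ∈ A ∧ v ∈ C) ∨ (v ∈ B ∧ v ∈ C) →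
      ∃ X ∈ 𝒬, ∃ Y ∈ 𝒬, X ⊆ A ∪ B ∪ C ∧ Y ⊆ A ∪ B ∪ C ∧ v ∈ X ∧ v ∈ Y ∧ (X ∩ Y).card = 2 := by
    rintro v (h | h | h)
    · exact ⟨A, hA, B, hB, sA, sB, h.1, h.2, by omega⟩
    · exact ⟨A, hA, C, hC, sA, sC, h.1, h.2, by omega⟩
    · exact ⟨B, hB, C, hC, sB, sC, h.1, h.2, by omega⟩
  have hBA : (B ∩ A).card + 2 = 4 := by rw [Finset.inter_comm]; exact hAB
  have hCA : (C ∩ A).card + 2 = 4 := by rw [Finset.inter_comm]; exact hAC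
  have hCB : (C ∩ B).card + 2 = 4 := by rw [Finset.inter_comm]; exact hBC
  intro v hv
  apply two
  simp only [Finset.mem_union] at hv
  rcases hv with (hv | hv) | hv
  · have := cover A B C cA hAB hAC h3 v hv
    tauto
  · have := cover B A C cB hBA hBC (by rw [Finset.inter_comm B A]; exact h3) v hv
    tauto
  · have := cover C A B cC hCA hCB
      (by rw [Finset.inter_assoc, Finset.inter_comm C]; exact h3) v hv
    tauto

/-- A system of `4`-cliques in a graph of maximum degree at most `5` without a cyclic chain of
cliques is hit by an independent set. -/
theorem exists_hitting_of_no_blobClosed {V : Type*} [Fintype V] [DecidableEq V] (n : ℕ) :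
    ∀ (G : SimpleGraph V) (𝒬 : Finset (Finset V)), 𝒬.card = n →
      (∀ v, (nbrs G v).card ≤ 5) → (∀ A ∈ 𝒬, G.IsNClique 4 A) →
      (∀ A ∈ 𝒬, ∀ B ∈ 𝒬, (A ∩ B).card + 1 = 4 → ¬ G.IsClique (↑(A ∪ B) : Set V)) →
      (∀ P : Finset V, P.Nonempty → ¬ BlobClosed 𝒬 P) →
      ∃ I : Finset V, (∀ x ∈ I, ∀ y ∈ I, ¬ G.Adj x y) ∧ ∀ A ∈ 𝒬, ∃ v ∈ A, v ∈ I := by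
  classical
  induction n using Nat.strong_induction_on with
  | _ n ih =>
  intro G 𝒬 hn hdeg hcl hpair hblob
  have hs := cliqueSystem_four hdeg hcl hpair hblob
  by_cases ht : MeetsTrans 𝒬
  · obtain ⟨I, hI, hhit, -⟩ := hs.exists_hitting le_rfl ht ∅ (by simp) (by simp) (by simp)
      (fun _ _ => ∅) (by simp) (by simp) (by simp)
    exact ⟨I, hI, hhit⟩
  have hex : ∃ A B C, CliqueChain 𝒬 A B C := by
    by_contra hcon
    refine ht fun A hA B hB C hC hAB hBC => ?_
    by_contra hAC
    exact hcon ⟨A, B, C, hA, hB, hC, hAB, hBC,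
      Finset.disjoint_iff_inter_eq_empty.2 (Finset.not_nonempty_iff_eq_empty.1 hAC)⟩
  obtain ⟨A, B, C, ch⟩ := hex
  have hAC := ch.disj
  let G' := contractChain G A B C hAC
  -- The virtual clique `E` replaces the three cliques of the chain. An independent set of `G'`
  -- hitting `E` meets only one of its halves, which is the input that `CliqueChain.extend` needs.
  let E := (A \ B) ∪ (C \ B)
  let 𝒬' := insert E (𝒬.filter (fun Q => Disjoint Q B))
  have cA := ch.card_sdiff hs
  have cC := ch.symm.card_sdiff hs
  obtain ⟨cAB, cBC⟩ := ch.card_inter hs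
  have hACd : Disjoint (A \ B) (C \ B) := Finset.disjoint_of_subset_left Finset.sdiff_subset
    (Finset.disjoint_of_subset_right Finset.sdiff_subset hAC)
  have cE : E.card = 4 := by
    rw [Finset.card_union_of_disjoint hACd, cA, cC]
  have mem𝒬' : ∀ Q, Q ∈ 𝒬' ↔ Q = E ∨ (Q ∈ 𝒬 ∧ Disjoint Q B) := by
    intro Q; simp [𝒬']
  have c𝒬' : 𝒬'.card < n := by
    have h1 : insert A (insert C (insert B (𝒬.filter (fun Q => Disjoint Q B)))) ⊆ 𝒬 := by
      intro Q hQ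
      simp only [Finset.mem_insert, Finset.mem_filter] at hQ
      rcases hQ with rfl | rfl | rfl | hQ
      exacts [ch.memA, ch.memC, ch.memB, hQ.1]
    have hB : ¬ Disjoint B B := by
      rw [Finset.disjoint_self_iff_empty]
      intro h0
      have := (hcl B ch.memB).2
      simp [h0] at this
    have hA' : ¬ Disjoint A B := Finset.not_disjoint_iff_nonempty_inter.2 ch.meetAB
    have hC' : ¬ Disjoint C B := Finset.not_disjoint_iff_nonempty_inter.2 ch.symm.meetAB
    have hne : ∀ X Y Z, CliqueChain 𝒬 X Y Z → X ≠ Y := by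
      rintro X Y Z hc rfl
      exact Finset.not_disjoint_iff_nonempty_inter.2 hc.meetBC hc.disj
    have hAC' : A ≠ C := by
      rintro rfl
      have := (hcl A ch.memA).2
      simp [(Finset.disjoint_self_iff_empty A).1 hAC] at this
    have h2 := Finset.card_le_card h1
    rw [Finset.card_insert_of_notMem, Finset.card_insert_of_notMem,
      Finset.card_insert_of_notMem] at h2
    · have := Finset.card_insert_le E (𝒬.filter (fun Q => Disjoint Q B))
      change (insert E (𝒬.filter (fun Q => Disjoint Q B))).card < n
      omega
    · exact fun hh => hB (Finset.mem_filter.1 hh).2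
    · simp [hC', hne _ _ _ ch.symm]
    · simp [hA', hne _ _ _ ch, hAC']
  have subA : ∀ Q ∈ 𝒬, Disjoint Q B → ∀ x ∈ A, x ∈ Q → A ∩ Q = A \ B :=
    fun Q hQ hd x hx hxQ => ch.inter_eq hs hQ hd hx hxQ
  have subC : ∀ Q ∈ 𝒬, Disjoint Q B → ∀ x ∈ C, x ∈ Q → C ∩ Q = C \ B :=
    fun Q hQ hd x hx hxQ => ch.symm.inter_eq hs hQ hd hx hxQ
  have midpoint : ∀ P : Finset V, A ⊆ P → B ⊆ P → C ⊆ P → ∀ v ∈ B,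
      ∃ X ∈ 𝒬, ∃ Y ∈ 𝒬, X ⊆ P ∧ Y ⊆ P ∧ v ∈ X ∧ v ∈ Y ∧ (X ∩ Y).card = 2 := by
    intro P hAP hBP hCP v hv
    rcases ch.mem_or_mem hs hv with h | h
    · exact ⟨A, ch.memA, B, ch.memB, hAP, hBP, h, hv, cAB⟩
    · exact ⟨B, ch.memB, C, ch.memC, hBP, hCP, hv, h, cBC⟩
  -- Otherwise `A`, `B`, `C`, `E` form a cyclic chain, so their union is closed.
  have hE : E ∉ 𝒬 := by
    intro hE
    have hEd : Disjoint E B := by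
      rw [Finset.disjoint_left]
      intro x hx
      rcases Finset.mem_union.1 hx with hx | hx <;> exact (Finset.mem_sdiff.1 hx).2
    refine hblob (A ∪ B ∪ C) ?_ ?_
    · obtain ⟨v, hv⟩ := ch.meetAB
      exact ⟨v, Finset.mem_union_left _ (Finset.mem_union_right _ (Finset.mem_inter.1 hv).2)⟩
    · have sA : A ⊆ A ∪ B ∪ C := Finset.subset_union_left.trans Finset.subset_union_left
      have sB : B ⊆ A ∪ B ∪ C := Finset.subset_union_right.trans Finset.subset_union_left
      have sC : C ⊆ A ∪ B ∪ C := Finset.subset_union_right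
      have sE : E ⊆ A ∪ B ∪ C :=
        Finset.union_subset (Finset.sdiff_subset.trans sA) (Finset.sdiff_subset.trans sC)
      intro v hv
      by_cases hvB : v ∈ B
      · exact midpoint _ sA sB sC v hvB
      simp only [Finset.mem_union, hvB, or_false] at hv
      rcases hv with hv | hv
      · have hvE : v ∈ E := Finset.mem_union_left _ (Finset.mem_sdiff.2 ⟨hv, hvB⟩)
        exact ⟨A, ch.memA, E, hE, sA, sE, hv, hvE, by rw [subA E hE hEd v hv hvE, cA]⟩
      · have hvE : v ∈ E := Finset.mem_union_right _ (Finset.mem_sdiff.2 ⟨hv, hvB⟩)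
        exact ⟨C, ch.memC, E, hE, sC, sE, hv, hvE, by rw [subC E hE hEd v hv hvE, cC]⟩
  have notboth : ∀ Q ∈ 𝒬, Disjoint Q B → ∀ x ∈ A, x ∈ Q → ∀ y ∈ C, y ∉ Q := by
    intro Q hQ hd x hx hxQ y hy hyQ
    have h1 := subA Q hQ hd x hx hxQ
    have h2 := subC Q hQ hd y hy hyQ
    have h3 : E ⊆ Q := Finset.union_subset (h1 ▸ Finset.inter_subset_right)
      (h2 ▸ Finset.inter_subset_right)
    exact hE ((Finset.eq_of_subset_of_card_le h3 (by rw [cE, (hcl Q hQ).2])) ▸ hQ)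
  have small : ∀ Q ∈ 𝒬, Disjoint Q B → ∀ Q' ∈ 𝒬, Disjoint Q' B → ∀ x ∈ A, x ∈ Q →
      ∀ y ∈ C, y ∈ Q' → (Q ∩ Q').card ≤ 2 := by
    intro Q hQ hd Q' hQ' hd' x hx hxQ y hy hyQ'
    have h1 := subA Q hQ hd x hx hxQ
    have h2 : Disjoint (Q ∩ Q') (A \ B) := by
      rw [Finset.disjoint_left]
      intro z hz hzA
      exact notboth Q' hQ' hd' z (Finset.mem_sdiff.1 hzA).1 (Finset.mem_inter.1 hz).2 y hy hyQ'
    have h3 : (Q ∩ Q') ∪ (A \ B) ⊆ Q := Finset.union_subset Finset.inter_subset_left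
      (h1 ▸ Finset.inter_subset_right)
    have h4 := Finset.card_le_card h3
    rw [Finset.card_union_of_disjoint h2, cA, (hcl Q hQ).2] at h4
    omega
  have smallE : ∀ Q ∈ 𝒬, Disjoint Q B → (E ∩ Q).card ≤ 2 := by
    intro Q hQ hd
    by_cases hx : ∃ x ∈ A, x ∈ Q
    · obtain ⟨x, hx, hxQ⟩ := hx
      rw [← cA]
      refine Finset.card_le_card fun z hz => ?_
      rw [Finset.mem_inter] at hz
      rcases Finset.mem_union.1 hz.1 with h | h
      · exact h
      · exact (notboth Q hQ hd x hx hxQ z (Finset.mem_sdiff.1 h).1 hz.2).elim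
    · push Not at hx
      rw [← cC]
      refine Finset.card_le_card fun z hz => ?_
      rw [Finset.mem_inter] at hz
      rcases Finset.mem_union.1 hz.1 with h | h
      · exact (hx z (Finset.mem_sdiff.1 h).1 hz.2).elim
      · exact h
  have hcl' : ∀ Q ∈ 𝒬', G'.IsNClique 4 Q := by
    intro Q hQ
    rcases (mem𝒬' Q).1 hQ with rfl | ⟨hQ, hd⟩
    · refine ⟨?_, cE⟩
      intro x hx y hy hxy
      rcases Finset.mem_union.1 hx with hx | hx <;> rcases Finset.mem_union.1 hy with hy | hy
      · have hx' := Finset.mem_sdiff.1 hx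
        have hy' := Finset.mem_sdiff.1 hy
        exact Or.inl ⟨(hcl A ch.memA).1 hx'.1 hy'.1 hxy, hx'.2, hy'.2⟩
      · exact Or.inr (Or.inl ⟨hx, hy⟩)
      · exact Or.inr (Or.inr ⟨hx, hy⟩)
      · have hx' := Finset.mem_sdiff.1 hx
        have hy' := Finset.mem_sdiff.1 hy
        exact Or.inl ⟨(hcl C ch.memC).1 hx'.1 hy'.1 hxy, hx'.2, hy'.2⟩
    · refine ⟨?_, (hcl Q hQ).2⟩
      intro x hx y hy hxy
      exact Or.inl ⟨(hcl Q hQ).1 hx hy hxy, Finset.disjoint_left.1 hd hx,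
        Finset.disjoint_left.1 hd hy⟩
  have hdeg' : ∀ v, (nbrs G' v).card ≤ 5 := by
    intro v
    by_cases hvA : v ∈ A \ B
    · refine ch.card_nbrs_contract_of_mem hs hvA fun w hw => ?_
      rcases hw with h | h | h
      · exact Or.inl ⟨h.1, h.2.2⟩
      · exact Or.inr h.2
      · exact (Finset.disjoint_left.1 hACd hvA h.1).elim
    by_cases hvC : v ∈ C \ B
    · refine ch.symm.card_nbrs_contract_of_mem hs hvC fun w hw => ?_
      rcases hw with h | h | h
      · exact Or.inl ⟨h.1, h.2.2⟩
      · exact (hvA h.1).elim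
      · exact Or.inr h.2
    · refine (Finset.card_le_card fun w hw => ?_).trans (hdeg v)
      rcases mem_nbrs.1 hw with h | h | h
      · exact mem_nbrs.2 h.1
      · exact (hvA h.1).elim
      · exact (hvC h.1).elim
  have hpair' : ∀ Q ∈ 𝒬', ∀ Q' ∈ 𝒬', (Q ∩ Q').card + 1 = 4 →
      ¬ G'.IsClique (↑(Q ∪ Q') : Set V) := by
    intro Q hQ Q' hQ' hc hclq
    rcases (mem𝒬' Q).1 hQ with rfl | ⟨hQ, hd⟩ <;> rcases (mem𝒬' Q').1 hQ' with rfl | ⟨hQ', hd'⟩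
    · rw [Finset.inter_self] at hc
      omega
    · have := smallE Q' hQ' hd'
      omega
    · have := smallE Q hQ hd
      rw [Finset.inter_comm] at hc
      omega
    · refine hpair Q hQ Q' hQ' hc ?_
      -- A new edge within `Q ∪ Q'` would put `A`- and `C`-vertices in the same clique, or in two
      -- cliques sharing at most two vertices. Hence the clique already exists in `G`.
      have novirt : ∀ x ∈ Q ∪ Q', ∀ y ∈ Q ∪ Q', x ∈ A \ B → y ∈ C \ B → False := by
        intro x hx y hy hxA hyC
        have hxA := (Finset.mem_sdiff.1 hxA).1
        have hyC := (Finset.mem_sdiff.1 hyC).1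
        rcases Finset.mem_union.1 hx with hx | hx <;> rcases Finset.mem_union.1 hy with hy | hy
        · exact notboth Q hQ hd x hxA hx y hyC hy
        · have := small Q hQ hd Q' hQ' hd' x hxA hx y hyC hy
          omega
        · have := small Q' hQ' hd' Q hQ hd x hxA hx y hyC hy
          rw [Finset.inter_comm] at this
          omega
        · exact notboth Q' hQ' hd' x hxA hx y hyC hy
      intro x hx y hy hxy
      rcases hclq hx hy hxy with h | h | h
      · exact h.1
      · exact (novirt x hx y hy h.1 h.2).elim
      · exact (novirt y hy x hx h.2 h.1).elim
  have hblob' : ∀ P : Finset V, P.Nonempty → ¬ BlobClosed 𝒬' P := by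
    intro P hP hbc
    by_cases hEP : E ⊆ P
    · refine hblob (P ∪ B) (hP.mono Finset.subset_union_left) ?_
      have sA : A ⊆ P ∪ B := by
        intro x hx
        by_cases hxB : x ∈ B
        · exact Finset.mem_union_right _ hxB
        · exact Finset.mem_union_left _
            (hEP (Finset.mem_union_left _ (Finset.mem_sdiff.2 ⟨hx, hxB⟩)))
      have sC : C ⊆ P ∪ B := by
        intro x hx
        by_cases hxB : x ∈ B
        · exact Finset.mem_union_right _ hxB
        · exact Finset.mem_union_left _
            (hEP (Finset.mem_union_right _ (Finset.mem_sdiff.2 ⟨hx, hxB⟩)))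
      have hP' : P ⊆ P ∪ B := Finset.subset_union_left
      have aux : ∀ v ∈ E, ∀ Y ∈ 𝒬, Disjoint Y B → Y ⊆ P → v ∈ Y →
          ∃ X ∈ 𝒬, ∃ Y ∈ 𝒬, X ⊆ P ∪ B ∧ Y ⊆ P ∪ B ∧ v ∈ X ∧ v ∈ Y ∧ (X ∩ Y).card = 2 := by
        intro v hv Y hY hd hYP hvY
        rcases Finset.mem_union.1 hv with hv | hv
        · have hv := (Finset.mem_sdiff.1 hv).1
          exact ⟨A, ch.memA, Y, hY, sA, hYP.trans hP', hv, hvY, by rw [subA Y hY hd v hv hvY, cA]⟩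
        · have hv := (Finset.mem_sdiff.1 hv).1
          exact ⟨C, ch.memC, Y, hY, sC, hYP.trans hP', hv, hvY, by rw [subC Y hY hd v hv hvY, cC]⟩
      intro v hv
      by_cases hvB : v ∈ B
      · exact midpoint _ sA Finset.subset_union_right sC v hvB
      have hvP := (Finset.mem_union.1 hv).resolve_right hvB
      obtain ⟨X, hX, Y, hY, hXP, hYP, hvX, hvY, hXY⟩ := hbc v hvP
      rcases (mem𝒬' X).1 hX with rfl | ⟨hX, hd⟩ <;> rcases (mem𝒬' Y).1 hY with rfl | ⟨hY, hd'⟩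
      · rw [Finset.inter_self] at hXY
        omega
      · exact aux v hvX Y hY hd' hYP hvY
      · exact aux v hvY X hX hd hXP hvX
      · exact ⟨X, hX, Y, hY, hXP.trans hP', hYP.trans hP', hvX, hvY, hXY⟩
    · refine hblob P hP fun v hv => ?_
      obtain ⟨X, hX, Y, hY, hXP, hYP, hvX, hvY, hXY⟩ := hbc v hv
      rcases (mem𝒬' X).1 hX with rfl | ⟨hX, -⟩
      · exact (hEP hXP).elim
      rcases (mem𝒬' Y).1 hY with rfl | ⟨hY, -⟩
      · exact (hEP hYP).elim
      exact ⟨X, hX, Y, hY, hXP, hYP, hvX, hvY, hXY⟩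
  obtain ⟨I, hI, hhit⟩ := ih _ c𝒬' G' 𝒬' rfl hdeg' hcl' hpair' hblob'
  have hI' : ∀ x ∈ I \ B, ∀ y ∈ I \ B, ¬ G.Adj x y := by
    intro x hx y hy hxy
    rw [Finset.mem_sdiff] at hx hy
    exact hI x hx.1 y hy.1 (Or.inl ⟨hxy, hx.2, hy.2⟩)
  have hhit' : ∀ Q ∈ 𝒬, Disjoint Q B → ∃ v ∈ Q, v ∈ I \ B := by
    intro Q hQ hd
    obtain ⟨v, hv, hvI⟩ := hhit Q ((mem𝒬' Q).2 (Or.inr ⟨hQ, hd⟩))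
    exact ⟨v, hv, Finset.mem_sdiff.2 ⟨hvI, Finset.disjoint_left.1 hd hv⟩⟩
  obtain ⟨x, hxE, hxI⟩ := hhit E ((mem𝒬' E).2 (Or.inl rfl))
  rcases Finset.mem_union.1 hxE with hx | hx
  · refine ch.extend hs hI' Finset.sdiff_disjoint
      (Finset.mem_sdiff.2 ⟨hxI, (Finset.mem_sdiff.1 hx).2⟩) (Finset.mem_sdiff.1 hx).1 ?_ hhit'
    rw [Finset.disjoint_left]
    intro y hy hyC
    rw [Finset.mem_sdiff] at hy
    exact hI x hxI y hy.1 (Or.inr (Or.inl ⟨hx, Finset.mem_sdiff.2 ⟨hyC, hy.2⟩⟩))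
  · refine ch.symm.extend hs hI' Finset.sdiff_disjoint
      (Finset.mem_sdiff.2 ⟨hxI, (Finset.mem_sdiff.1 hx).2⟩) (Finset.mem_sdiff.1 hx).1 ?_ hhit'
    rw [Finset.disjoint_left]
    intro y hy hyA
    rw [Finset.mem_sdiff] at hy
    exact hI x hxI y hy.1 (Or.inr (Or.inr ⟨hx, Finset.mem_sdiff.2 ⟨hyA, hy.2⟩⟩))

/-! ### Removing independent sets, with vertices kept but isolated. -/

/-- The graph obtained by deleting all edges at the vertices of `I`. -/
def isolate {V : Type*} (G : SimpleGraph V) (I : Finset V) : SimpleGraph V where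
  Adj x y := G.Adj x y ∧ x ∉ I ∧ y ∉ I
  symm := ⟨fun _ _ h => ⟨h.1.symm, h.2.2, h.2.1⟩⟩
  loopless := ⟨fun x h => G.loopless.irrefl x h.1⟩

/-- The cliques with `q` vertices. -/
noncomputable def cliques {V : Type*} [Fintype V] (G : SimpleGraph V) (q : ℕ) :
    Finset (Finset V) := by
  classical exact Finset.univ.filter (G.IsNClique q)

theorem mem_cliques {V : Type*} [Fintype V] {G : SimpleGraph V} {q : ℕ} {A : Finset V} :
    A ∈ cliques G q ↔ G.IsNClique q A := by
  classical
  simp [cliques]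

/-- A colouring with colours `0, …, m` in which all colours but `0` are used properly, and colour
`0` spans no `4`-clique. -/
def HasMixedColoring {V : Type*} (G : SimpleGraph V) (m : ℕ) : Prop :=
  ∃ c : V → ℕ, (∀ v, c v ≤ m) ∧ (∀ v w, G.Adj v w → c v = c w → c v = 0) ∧
    ∀ S : Finset V, G.IsNClique 4 S → ∃ v ∈ S, c v ≠ 0

section isolate

variable {V : Type*} {G : SimpleGraph V} {I : Finset V}

theorem isNClique_of_isolate {q : ℕ} {S : Finset V} (h : (isolate G I).IsNClique q S) :
    G.IsNClique q S :=
  ⟨fun _ hx _ hy hxy => (h.1 hx hy hxy).1, h.2⟩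

theorem notMem_of_isolate_clique {q : ℕ} (hq : 2 ≤ q) {S : Finset V}
    (h : (isolate G I).IsNClique q S) {v : V} (hv : v ∈ S) : v ∉ I := by
  obtain ⟨w, hw, hwv⟩ := Finset.exists_mem_ne (by rw [h.2]; omega : 1 < S.card) v
  exact (h.1 hv hw hwv.symm).2.1

theorem isNClique_isolate {q : ℕ} {S : Finset V} (h : G.IsNClique q S) (hS : ∀ v ∈ S, v ∉ I) :
    (isolate G I).IsNClique q S :=
  ⟨fun x hx y hy hxy => ⟨h.1 hx hy hxy, hS x hx, hS y hy⟩, h.2⟩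

theorem cliqueFree_isolate {q : ℕ} (hq : 2 ≤ q)
    (h : ∀ A : Finset V, G.IsNClique q A → ∃ v ∈ A, v ∈ I) : (isolate G I).CliqueFree q := by
  intro S hS
  obtain ⟨v, hv, hvI⟩ := h S (isNClique_of_isolate hS)
  exact notMem_of_isolate_clique hq hS hv hvI

theorem HasMixedColoring.of_isolate {m : ℕ} (hI : ∀ x ∈ I, ∀ y ∈ I, ¬ G.Adj x y)
    (h : HasMixedColoring (isolate G I) m) : HasMixedColoring G (m + 1) := by
  classical
  obtain ⟨c, hc, hprop, h4⟩ := h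
  have hout : ∀ v, v ∉ I → (if v ∈ I then m + 1 else c v) = c v := fun v hv => by simp [hv]
  refine ⟨fun v => if v ∈ I then m + 1 else c v, ?_, ?_, ?_⟩
  · intro v
    have := hc v
    dsimp only
    split_ifs <;> omega
  · intro v w hvw hcol
    have hv := hc v
    have hw := hc w
    by_cases hvI : v ∈ I <;> by_cases hwI : w ∈ I <;> simp only [hvI, hwI, if_true, if_false] at hcol ⊢
    · exact (hI v hvI w hwI hvw).elim
    · omega
    · omega
    · exact hprop v w ⟨hvw, hvI, hwI⟩ hcol
  · intro S hS
    by_cases hSI : ∃ v ∈ S, v ∈ I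
    · obtain ⟨v, hv, hvI⟩ := hSI
      exact ⟨v, hv, by simp [hvI]⟩
    · push Not at hSI
      obtain ⟨v, hv, hcv⟩ := h4 S (isNClique_isolate hS hSI)
      exact ⟨v, hv, by simpa [hSI v hv] using hcv⟩

theorem hasMixedColoring_zero (h : G.CliqueFree 4) : HasMixedColoring G 0 :=
  ⟨fun _ => 0, by simp, by simp, fun S hS => (h S hS).elim⟩

variable [Fintype V]

theorem exists_maximal_independent (hI : ∀ x ∈ I, ∀ y ∈ I, ¬ G.Adj x y) :
    ∃ J : Finset V, I ⊆ J ∧ (∀ x ∈ J, ∀ y ∈ J, ¬ G.Adj x y) ∧ ∀ v, v ∉ J → ∃ u ∈ J, G.Adj v u := by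
  classical
  obtain ⟨J, hIJ, hJ⟩ := (Set.toFinite
    {J : Finset V | ∀ x ∈ J, ∀ y ∈ J, ¬ G.Adj x y}).exists_le_maximal hI
  refine ⟨J, hIJ, hJ.prop, fun v hv => ?_⟩
  by_contra hcon
  push Not at hcon
  refine hv (hJ.le_of_ge (y := insert v J) ?_ (Finset.subset_insert _ _)
    (Finset.mem_insert_self _ _))
  intro x hx y hy
  rcases Finset.mem_insert.1 hx with hx' | hx' <;> rcases Finset.mem_insert.1 hy with hy' | hy'
  · rw [hx', hy']; exact G.loopless.irrefl _
  · rw [hx']; exact hcon y hy'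
  · rw [hy']; exact fun hh => hcon x hx' hh.symm
  · exact hJ.prop x hx' y hy'

/-- By maximality each vertex outside `I` loses a neighbour. -/
theorem card_nbrs_isolate_le {d : ℕ} (hd : ∀ v, (nbrs G v).card ≤ d + 1)
    (hmax : ∀ v, v ∉ I → ∃ u ∈ I, G.Adj v u) (v : V) : (nbrs (isolate G I) v).card ≤ d := by
  classical
  by_cases hv : v ∈ I
  · have : nbrs (isolate G I) v = ∅ := by
      ext w
      simp only [mem_nbrs, Finset.notMem_empty, iff_false]
      exact fun h => h.2.1 hv
    simp [this]
  · obtain ⟨u, hu, hvu⟩ := hmax v hv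
    have h1 : nbrs (isolate G I) v ⊂ nbrs G v := by
      refine Finset.ssubset_iff_of_subset ?_ |>.2 ⟨u, mem_nbrs.2 hvu, ?_⟩
      · intro w hw
        exact mem_nbrs.2 (mem_nbrs.1 hw).1
      · rw [mem_nbrs]
        exact fun h => h.2.2 hu
    have := Finset.card_lt_card h1
    have := hd v
    omega

end isolate

section all_cliques

variable {V : Type*} [Fintype V] [DecidableEq V] {G : SimpleGraph V} {q : ℕ}

/-- A violation of `pair` is itself a (q + 1)-clique. In a violation of `triple`, counting gives `C
⊆ A ∪ B`, so a vertex of `A ∩ B` outside `C` extends `C` to one. -/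
theorem cliqueSystem_cliques (hd : ∀ v, (nbrs G v).card ≤ q + 1) (hf : G.CliqueFree (q + 1)) :
    CliqueSystem G q (cliques G q) := by
  refine ⟨hd, fun A hA => mem_cliques.1 hA, ?_, ?_⟩
  · intro A hA B hB hAB hcl
    rw [mem_cliques] at hA hB
    refine hf (A ∪ B) ⟨hcl, ?_⟩
    have := Finset.card_union_add_card_inter A B
    rw [hA.2, hB.2] at this
    omega
  · intro A hA B hB C hC hAB hAC hBC h3
    rw [mem_cliques] at hA hB hC
    have hincl : (C ∩ (A ∪ B)).card + (A ∩ B ∩ C).card = (A ∩ C).card + (B ∩ C).card := by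
      have := Finset.card_union_add_card_inter (A ∩ C) (B ∩ C)
      rw [← Finset.union_inter_distrib_right] at this
      rw [← this, Finset.inter_comm C]
      congr 2
      ext x
      simp only [Finset.mem_inter]
      tauto
    have hsub : C ⊆ A ∪ B := by
      have cC := hC.2
      exact Finset.inter_eq_left.1
        (Finset.eq_of_subset_of_card_le Finset.inter_subset_left (by omega))
    have hex : ∃ a ∈ A ∩ B, a ∉ C := by
      by_contra hcon
      push Not at hcon
      rw [Finset.inter_eq_left.2 hcon] at h3
      omega
    obtain ⟨a, ha, haC⟩ := hex
    rw [Finset.mem_inter] at ha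
    refine hf (insert a C) (hC.insert fun b hb => ?_)
    have hab : a ≠ b := fun hh => haC (hh ▸ hb)
    rcases Finset.mem_union.1 (hsub hb) with h | h
    · exact hA.1 ha.1 h hab
    · exact hB.1 ha.2 h hab

/-- Two disjoint overlaps of size at least q - 2 inside `B` would force 2(q - 2) ≤ q, which fails
exactly from q = 5 on. -/
theorem CliqueSystem.meetsTrans (hq : 5 ≤ q) {𝒬 : Finset (Finset V)} (h : CliqueSystem G q 𝒬) :
    MeetsTrans 𝒬 := by
  intro A hA B hB C hC hAB hBC
  have h1 := h.le_card_inter hA hB hAB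
  have h2 := h.le_card_inter hB hC hBC
  by_contra hAC
  have h3 : Disjoint (A ∩ B) (B ∩ C) := by
    rw [Finset.disjoint_left]
    intro x hx hx'
    rw [Finset.mem_inter] at hx hx'
    exact hAC ⟨x, Finset.mem_inter.2 ⟨hx.1, hx'.2⟩⟩
  have h4 := Finset.card_le_card (Finset.union_subset
    (Finset.inter_subset_right : A ∩ B ⊆ B) (Finset.inter_subset_left : B ∩ C ⊆ B))
  rw [Finset.card_union_of_disjoint h3, (h.clique B hB).2] at h4
  omega

/-- For `q ≥ 5`, in a graph of maximum degree at most `q + 1` without `(q + 1)`-clique an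
independent set hits all `q`-cliques. -/
theorem exists_maximal_independent_hitting_cliques (hq : 5 ≤ q)
    (hd : ∀ v, (nbrs G v).card ≤ q + 1) (hf : G.CliqueFree (q + 1)) :
    ∃ I : Finset V, (∀ x ∈ I, ∀ y ∈ I, ¬ G.Adj x y) ∧ (∀ v, v ∉ I → ∃ u ∈ I, G.Adj v u) ∧
      ∀ A : Finset V, G.IsNClique q A → ∃ v ∈ A, v ∈ I := by
  have hs := cliqueSystem_cliques hd hf
  obtain ⟨I, hI, hhit, -⟩ := hs.exists_hitting (by omega) (hs.meetsTrans hq) ∅ (by simp) (by simp)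
    (by simp) (fun _ _ => ∅) (by simp) (by simp) (by simp)
  obtain ⟨J, hIJ, hJ, hmax⟩ := exists_maximal_independent hI
  refine ⟨J, hJ, hmax, fun A hA => ?_⟩
  obtain ⟨v, hv, hvI⟩ := hhit A (mem_cliques.2 hA)
  exact ⟨v, hv, hIJ hvI⟩

/-- In a graph of maximum degree at most `5` without `5`-clique and without cyclic chain of
`4`-cliques an independent set hits all `4`-cliques. -/
theorem exists_independent_hitting_four_cliques (hd : ∀ v, (nbrs G v).card ≤ 5)
    (hf : G.CliqueFree 5) (hb : ∀ P : Finset V, P.Nonempty → ¬ BlobClosed (cliques G 4) P) :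
    ∃ I : Finset V, (∀ x ∈ I, ∀ y ∈ I, ¬ G.Adj x y) ∧
      ∀ A : Finset V, G.IsNClique 4 A → ∃ v ∈ A, v ∈ I := by
  have hs := cliqueSystem_cliques (q := 4) hd hf
  obtain ⟨I, hI, hhit⟩ := exists_hitting_of_no_blobClosed _ G (cliques G 4) rfl hd hs.clique
    hs.pair hb
  exact ⟨I, hI, fun A hA => hhit A (mem_cliques.2 hA)⟩

end all_cliques

/-! ### Blob sets. -/

/-- Every vertex of `P` lies in two `4`-cliques inside `P` that share exactly two vertices and
contain all its neighbours in `P`. -/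
def IsBlobSet {V : Type*} [DecidableEq V] (G : SimpleGraph V) (P : Finset V) : Prop :=
  ∀ v ∈ P, ∃ A B : Finset V, G.IsNClique 4 A ∧ G.IsNClique 4 B ∧ A ⊆ P ∧ B ⊆ P ∧ v ∈ A ∧ v ∈ B ∧
    (A ∩ B).card = 2 ∧ ∀ w ∈ P, G.Adj v w → w ∈ A ∪ B

/-- An inclusion-minimal non-empty blob set. -/
structure IsMinBlobSet {V : Type*} [DecidableEq V] (G : SimpleGraph V) (P : Finset V) : Prop where
  nonempty : P.Nonempty
  blob : IsBlobSet G P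
  minimal : ∀ P' ⊆ P, P'.Nonempty → IsBlobSet G P' → P' = P

/-- The closed neighbourhood of `v` inside `P`. -/
noncomputable def closedNbrs {V : Type*} (G : SimpleGraph V) (P : Finset V) (v : V) :
    Finset V := by
  classical exact P.filter (fun w => w = v ∨ G.Adj v w)

/-- The minimal blob sets that meet no `5`-clique. -/
noncomputable def freeBlobs {V : Type*} [Fintype V] [DecidableEq V] (G : SimpleGraph V) :
    Finset (Finset V) := by
  classical
  exact Finset.univ.filter
    (fun P => IsMinBlobSet G P ∧ ∀ Q : Finset V, G.IsNClique 5 Q → Disjoint P Q)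

theorem mem_closedNbrs {V : Type*} {G : SimpleGraph V} {P : Finset V} {v w : V} :
    w ∈ closedNbrs G P v ↔ w ∈ P ∧ (w = v ∨ G.Adj v w) := by
  classical
  simp [closedNbrs]

theorem mem_freeBlobs {V : Type*} [Fintype V] [DecidableEq V] {G : SimpleGraph V} {P : Finset V} :
    P ∈ freeBlobs G ↔ IsMinBlobSet G P ∧ ∀ Q : Finset V, G.IsNClique 5 Q → Disjoint P Q := by
  classical
  simp [freeBlobs]

section blobs

variable {V : Type*} [DecidableEq V] {G : SimpleGraph V} {P P' : Finset V}

theorem adj_or_eq_of_clique {q : ℕ} {A : Finset V} (hA : G.IsNClique q A) {v w : V} (hv : v ∈ A)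
    (hw : w ∈ A) : w = v ∨ G.Adj v w := by
  by_cases h : w = v
  · exact Or.inl h
  · exact Or.inr (hA.1 hv hw (Ne.symm h))

theorem card_union_four {q : ℕ} {A B : Finset V} (hA : G.IsNClique 4 A) (hB : G.IsNClique 4 B)
    (hAB : (A ∩ B).card = q) : (A ∪ B).card + q = 8 := by
  have := Finset.card_union_add_card_inter A B
  rw [hA.2, hB.2] at this
  omega

theorem IsBlobSet.exists_cliques (hP : IsBlobSet G P) {v : V} (hv : v ∈ P) :
    ∃ A B : Finset V, G.IsNClique 4 A ∧ G.IsNClique 4 B ∧ A ⊆ P ∧ B ⊆ P ∧ v ∈ A ∧ v ∈ B ∧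
      (A ∩ B).card = 2 ∧ closedNbrs G P v = A ∪ B ∧ (closedNbrs G P v).card = 6 := by
  obtain ⟨A, B, hA, hB, hAP, hBP, hvA, hvB, hAB, hN⟩ := hP v hv
  have heq : closedNbrs G P v = A ∪ B := by
    ext w
    rw [mem_closedNbrs]
    constructor
    · rintro ⟨hw, rfl | h⟩
      · exact Finset.mem_union_left _ hvA
      · exact hN w hw h
    · intro hw
      rcases Finset.mem_union.1 hw with hw | hw
      · exact ⟨hAP hw, adj_or_eq_of_clique hA hvA hw⟩
      · exact ⟨hBP hw, adj_or_eq_of_clique hB hvB hw⟩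
  refine ⟨A, B, hA, hB, hAP, hBP, hvA, hvB, hAB, heq, ?_⟩
  have := card_union_four hA hB hAB
  rw [heq]
  omega

/-- The twin `t` is the other vertex of `A ∩ B`. A vertex adjacent to the whole closed neighbourhood
must lie in both cliques, or it would extend one to a 5-clique inside `P`. -/
theorem IsBlobSet.exists_twin (hP : IsBlobSet G P)
    (hfree : ∀ Q : Finset V, G.IsNClique 5 Q → ¬ Q ⊆ P) {v : V} (hv : v ∈ P) :
    ∃ t ∈ P, t ≠ v ∧ closedNbrs G P t = closedNbrs G P v ∧
      ∀ x ∈ closedNbrs G P v, (∀ y ∈ closedNbrs G P v, y = x ∨ G.Adj x y) → x = v ∨ x = t := by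
  obtain ⟨A, B, hA, hB, hAP, hBP, hvA, hvB, hAB, heq, hc⟩ := hP.exists_cliques hv
  have hvAB : v ∈ A ∩ B := Finset.mem_inter.2 ⟨hvA, hvB⟩
  obtain ⟨t, ht⟩ := Finset.card_eq_one.1 (by
    rw [Finset.card_erase_of_mem hvAB, hAB] : ((A ∩ B).erase v).card = 1)
  have htm : t ∈ (A ∩ B).erase v := by rw [ht]; exact Finset.mem_singleton_self t
  rw [Finset.mem_erase, Finset.mem_inter] at htm
  have htP := hAP htm.2.1
  refine ⟨t, htP, htm.1, ?_, ?_⟩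
  · obtain ⟨-, -, -, -, -, -, -, -, -, -, hct⟩ := hP.exists_cliques htP
    symm
    refine Finset.eq_of_subset_of_card_le ?_ (by rw [hct, hc])
    intro w hw
    rw [heq] at hw
    rw [mem_closedNbrs]
    rcases Finset.mem_union.1 hw with hw | hw
    · exact ⟨hAP hw, adj_or_eq_of_clique hA htm.2.1 hw⟩
    · exact ⟨hBP hw, adj_or_eq_of_clique hB htm.2.2 hw⟩
  · intro x hx huniv
    have key : ∀ D : Finset V, G.IsNClique 4 D → D ⊆ P → D ⊆ closedNbrs G P v → x ∈ D := by
      intro D hD hDP hDv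
      by_contra hxD
      refine hfree (insert x D) (hD.insert fun b hb => ?_) ?_
      · exact (huniv b (hDv hb)).resolve_left (fun hh => hxD (hh ▸ hb))
      · exact Finset.insert_subset (mem_closedNbrs.1 hx).1 hDP
    have hxAB : x ∈ A ∩ B := Finset.mem_inter.2
      ⟨key A hA hAP (heq ▸ Finset.subset_union_left), key B hB hBP (heq ▸ Finset.subset_union_right)⟩
    by_cases hxv : x = v
    · exact Or.inl hxv
    · right
      have : x ∈ (A ∩ B).erase v := Finset.mem_erase.2 ⟨hxv, hxAB⟩
      rw [ht] at this
      exact Finset.mem_singleton.1 this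

theorem IsBlobSet.card_erase (hP : IsBlobSet G P) {v : V} (hv : v ∈ P) :
    ((closedNbrs G P v).erase v).card = 5 := by
  obtain ⟨-, -, -, -, -, -, -, -, -, -, hc⟩ := hP.exists_cliques hv
  rw [Finset.card_erase_of_mem (mem_closedNbrs.2 ⟨hv, Or.inl rfl⟩), hc]

theorem IsBlobSet.exists_min (hP : IsBlobSet G P) (hne : P.Nonempty) :
    ∃ P' ⊆ P, IsMinBlobSet G P' := by
  induction h : P.card using Nat.strong_induction_on generalizing P with
  | _ n ih =>
  by_cases hmin : ∀ P' ⊆ P, P'.Nonempty → IsBlobSet G P' → P' = P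
  · exact ⟨P, subset_rfl, hne, hP, hmin⟩
  · push Not at hmin
    obtain ⟨P', hsub, hne', hP', hneq⟩ := hmin
    have hlt := Finset.card_lt_card (Finset.ssubset_iff_subset_ne.2 ⟨hsub, hneq⟩)
    obtain ⟨P'', h1, h2⟩ := ih _ (h ▸ hlt) hP' hne' rfl
    exact ⟨P'', h1.trans hsub, h2⟩

variable [Fintype V]

theorem closedNbrs_subset (v : V) : (closedNbrs G P v).erase v ⊆ nbrs G v := by
  intro w hw
  rw [Finset.mem_erase, mem_closedNbrs] at hw
  exact mem_nbrs.2 (hw.2.2.resolve_left hw.1)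

/-- Five of the at most six neighbours lie in `P`. -/
theorem IsBlobSet.card_nbrs_sdiff (hP : IsBlobSet G P) (hd : ∀ v, (nbrs G v).card ≤ 6) {v : V}
    (hv : v ∈ P) : (nbrs G v \ P).card ≤ 1 := by
  have h1 : Disjoint (nbrs G v \ P) ((closedNbrs G P v).erase v) := by
    rw [Finset.disjoint_left]
    intro w hw hw'
    exact (Finset.mem_sdiff.1 hw).2 (mem_closedNbrs.1 (Finset.mem_of_mem_erase hw')).1
  have h2 := Finset.card_le_card (Finset.union_subset
    (Finset.sdiff_subset : nbrs G v \ P ⊆ nbrs G v) (closedNbrs_subset (P := P) v))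
  rw [Finset.card_union_of_disjoint h1, hP.card_erase hv] at h2
  have := hd v
  omega

theorem IsBlobSet.outside_unique (hP : IsBlobSet G P) (hd : ∀ v, (nbrs G v).card ≤ 6) {v : V}
    (hv : v ∈ P) {z z' : V} (hz : z ∉ P) (hz' : z' ∉ P) (h : G.Adj v z) (h' : G.Adj v z') :
    z = z' :=
  Finset.card_le_one.1 (hP.card_nbrs_sdiff hd hv) z (Finset.mem_sdiff.2 ⟨mem_nbrs.2 h, hz⟩) z'
    (Finset.mem_sdiff.2 ⟨mem_nbrs.2 h', hz'⟩)

/-- Near `y` the only edges leaving `P'` go to `y`, so the twin `t` of `y` in `P` lies in `P'`, and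
so do their common neighbours. The twin of `t` in `P'` is the required `z`; inside `P` it would be a
third universal vertex. -/
theorem IsBlobSet.overlap_of_adj (hP : IsBlobSet G P) (hP' : IsBlobSet G P')
    (hd : ∀ v, (nbrs G v).card ≤ 6)
    (hfree : ∀ Q : Finset V, G.IsNClique 5 Q → ¬ Q ⊆ P)
    (hfree' : ∀ Q : Finset V, G.IsNClique 5 Q → ¬ Q ⊆ P')
    {v y : V} (hv : v ∈ P) (hv' : v ∈ P') (hy : y ∈ P) (hy' : y ∉ P') (hvy : G.Adj v y) :
    (∀ w ∈ P, G.Adj y w → w ∈ P') ∧ ∃ z, z ∉ P ∧ ∀ w ∈ P, G.Adj y w → G.Adj z w := by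
  have near : ∀ u ∈ P', G.Adj u y → ∀ w, G.Adj u w → w ≠ y → w ∈ P' := by
    intro u hu huy w huw hwy
    by_contra hw
    exact hwy (hP'.outside_unique hd hu hw hy' huw huy)
  obtain ⟨t, htP, hty, hcn, huniv⟩ := hP.exists_twin hfree hy
  have mem_t : ∀ w ∈ P, G.Adj y w → w = t ∨ G.Adj t w := by
    intro w hw hyw
    have : w ∈ closedNbrs G P t := by
      rw [hcn]; exact mem_closedNbrs.2 ⟨hw, Or.inr hyw⟩
    exact (mem_closedNbrs.1 this).2
  have hty' : G.Adj t y := by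
    have : y ∈ closedNbrs G P t := by
      rw [hcn]; exact mem_closedNbrs.2 ⟨hy, Or.inl rfl⟩
    exact (mem_closedNbrs.1 this).2.resolve_left hty.symm
  have htP' : t ∈ P' := by
    rcases mem_t v hv hvy.symm with h | h
    · exact h ▸ hv'
    · exact near v hv' hvy t h.symm hty
  have first : ∀ w ∈ P, G.Adj y w → w ∈ P' := by
    intro w hw hyw
    rcases mem_t w hw hyw with h | h
    · exact h ▸ htP'
    · exact near t htP' hty' w h (fun hh => G.loopless.irrefl y (hh ▸ hyw))
  obtain ⟨z, hzP', hzt, hcn', -⟩ := hP'.exists_twin hfree' htP'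
  have mem_z : ∀ w ∈ P', (w = t ∨ G.Adj t w) → w = z ∨ G.Adj z w := by
    intro w hw htw
    have : w ∈ closedNbrs G P' z := by
      rw [hcn']; exact mem_closedNbrs.2 ⟨hw, htw⟩
    exact (mem_closedNbrs.1 this).2
  have hzadj : G.Adj t z := by
    have : z ∈ closedNbrs G P' t := by
      rw [← hcn']; exact mem_closedNbrs.2 ⟨hzP', Or.inl rfl⟩
    exact (mem_closedNbrs.1 this).2.resolve_left hzt
  have hzP : z ∉ P := by
    intro hzP
    have hzy : z ∈ closedNbrs G P y := by
      rw [← hcn]; exact mem_closedNbrs.2 ⟨hzP, Or.inr hzadj⟩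
    have hzney : z ≠ y := fun hh => hy' (hh ▸ hzP')
    have hyz : G.Adj y z := (mem_closedNbrs.1 hzy).2.resolve_left hzney
    refine (huniv z hzy fun w hw => ?_).elim hzney hzt
    obtain ⟨hwP, rfl | hyw⟩ := mem_closedNbrs.1 hw
    · exact Or.inr hyz.symm
    · exact mem_z w (first w hwP hyw) (mem_t w hwP hyw)
  refine ⟨first, z, hzP, fun w hw hyw => ?_⟩
  exact (mem_z w (first w hw hyw) (mem_t w hw hyw)).resolve_left (fun hh => hzP (hh ▸ hw))

theorem IsMinBlobSet.overlap (hP : IsMinBlobSet G P) (hP' : IsBlobSet G P')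
    (hd : ∀ v, (nbrs G v).card ≤ 6)
    (hfree : ∀ Q : Finset V, G.IsNClique 5 Q → ¬ Q ⊆ P)
    (hfree' : ∀ Q : Finset V, G.IsNClique 5 Q → ¬ Q ⊆ P')
    (hmeet : (P ∩ P').Nonempty) {y : V} (hy : y ∈ P) (hy' : y ∉ P') :
    ∃ z, z ∉ P ∧ ∀ w ∈ P, G.Adj y w → G.Adj z w := by
  classical
  -- `Y` is closed under adjacency in `P`, hence a blob set, and by minimality it is all of `P`.
  let Y := P.filter (fun y => y ∈ P' ∨ ∀ w ∈ P, G.Adj y w → w ∈ P')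
  have hYP : Y ⊆ P := Finset.filter_subset _ _
  have hclosed : ∀ v ∈ Y, ∀ w ∈ P, G.Adj v w → w ∈ Y := by
    intro v hv w hw hvw
    obtain ⟨hvP, hv⟩ := Finset.mem_filter.1 hv
    refine Finset.mem_filter.2 ⟨hw, ?_⟩
    by_cases hwP' : w ∈ P'
    · exact Or.inl hwP'
    right
    rcases hv with hv | hv
    · exact (hP.blob.overlap_of_adj hP' hd hfree hfree' hvP hv hw hwP' hvw).1
    · exact (hwP' (hv w hw hvw)).elim
  have hYblob : IsBlobSet G Y := by
    intro v hv
    obtain ⟨A, B, hA, hB, hAP, hBP, hvA, hvB, hAB, hN⟩ := hP.blob v (hYP hv)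
    have sub : ∀ D : Finset V, G.IsNClique 4 D → D ⊆ P → v ∈ D → D ⊆ Y := by
      intro D hD hDP hvD w hw
      rcases adj_or_eq_of_clique hD hvD hw with rfl | h
      · exact hv
      · exact hclosed v hv w (hDP hw) h
    exact ⟨A, B, hA, hB, sub A hA hAP hvA, sub B hB hBP hvB, hvA, hvB, hAB,
      fun w hw => hN w (hYP hw)⟩
  have hYne : Y.Nonempty := by
    obtain ⟨v, hv⟩ := hmeet
    rw [Finset.mem_inter] at hv
    exact ⟨v, Finset.mem_filter.2 ⟨hv.1, Or.inl hv.2⟩⟩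
  have hYeq := hP.minimal Y hYP hYne hYblob
  have hyY : y ∈ Y := hYeq.symm ▸ hy
  have hN := (Finset.mem_filter.1 hyY).2.resolve_left hy'
  obtain ⟨v, hv⟩ := Finset.card_pos.1 (by rw [hP.blob.card_erase hy]; norm_num :
    0 < ((closedNbrs G P y).erase y).card)
  rw [Finset.mem_erase, mem_closedNbrs] at hv
  have hyv := hv.2.2.resolve_left hv.1
  exact (hP.blob.overlap_of_adj hP' hd hfree hfree' hv.2.1 (hN v hv.2.1 hyv) hy hy' hyv.symm).2

theorem not_subset_of_mem_freeBlobs (hP : P ∈ freeBlobs G) (Q : Finset V) (hQ : G.IsNClique 5 Q) :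
    ¬ Q ⊆ P := by
  intro hsub
  obtain ⟨v, hv⟩ := Finset.card_pos.1 (by rw [hQ.2]; norm_num : 0 < Q.card)
  exact Finset.disjoint_left.1 ((mem_freeBlobs.1 hP).2 Q hQ) (hsub hv) hv

/-- Vertices of `P` outside the core are pairwise non-adjacent: two adjacent ones lie in a 4-clique
of `P`, have the same outside companion `z`, and `z` completes a 5-clique meeting `P`. So the five
`P`-neighbours of some vertex all lie in the core. -/
theorem three_le_card_core (hd : ∀ v, (nbrs G v).card ≤ 6) (hP : P ∈ freeBlobs G) :
    3 ≤ (core (freeBlobs G) P).card := by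
  have hmin := (mem_freeBlobs.1 hP).1
  have hfree := not_subset_of_mem_freeBlobs hP
  have hz : ∀ y ∈ P, y ∉ core (freeBlobs G) P →
      ∃ z, z ∉ P ∧ ∀ w ∈ P, G.Adj y w → G.Adj z w := by
    intro y hy hyc
    rw [mem_core] at hyc
    push Not at hyc
    obtain ⟨P', hP', hmeet, hy'⟩ := hyc
    exact hmin.overlap (mem_freeBlobs.1 hP').1.blob hd hfree (not_subset_of_mem_freeBlobs hP')
      hmeet hy hy'
  have hindep : ∀ y ∈ P, y ∉ core (freeBlobs G) P → ∀ y' ∈ P, G.Adj y y' →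
      y' ∈ core (freeBlobs G) P := by
    intro y hy hyc y' hy' hadj
    by_contra hyc'
    obtain ⟨z, hzP, hz1⟩ := hz y hy hyc
    obtain ⟨z', hzP', hz2⟩ := hz y' hy' hyc'
    obtain ⟨A, B, hA, hB, hAP, hBP, hyA, hyB, hAB, heq, hc⟩ := hmin.blob.exists_cliques hy
    have common : ∀ D : Finset V, G.IsNClique 4 D → D ⊆ P → y ∈ D → y' ∈ D → False := by
      intro D hD hDP hyD hyD'
      have hcd : 0 < ((D.erase y).erase y').card := by
        have h1 := Finset.pred_card_le_card_erase (s := D.erase y) (a := y')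
        have h2 := Finset.pred_card_le_card_erase (s := D) (a := y)
        rw [hD.2] at h2
        omega
      obtain ⟨v, hv⟩ := Finset.card_pos.1 hcd
      rw [Finset.mem_erase, Finset.mem_erase] at hv
      have hvP := hDP hv.2.2
      have e1 := hz1 v hvP (hD.1 hyD hv.2.2 hv.2.1.symm)
      have e2 := hz2 v hvP (hD.1 hyD' hv.2.2 hv.1.symm)
      have hzz := hmin.blob.outside_unique hd hvP hzP hzP' e1.symm e2.symm
      have hclq : G.IsNClique 5 (insert z D) := by
        refine hD.insert fun b hb => ?_
        by_cases hby : b = y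
        · rw [hby, hzz]
          exact hz2 y hy hadj.symm
        · exact hz1 b (hDP hb) (hD.1 hyD hb (Ne.symm hby))
      exact Finset.disjoint_left.1 ((mem_freeBlobs.1 hP).2 _ hclq) hy
        (Finset.mem_insert_of_mem hyD)
    have : y' ∈ A ∪ B := heq ▸ mem_closedNbrs.2 ⟨hy', Or.inr hadj⟩
    rcases Finset.mem_union.1 this with h | h
    · exact common A hA hAP hyA h
    · exact common B hB hBP hyB h
  have bound : ∀ y ∈ P, (closedNbrs G P y).erase y ⊆ core (freeBlobs G) P →
      3 ≤ (core (freeBlobs G) P).card := by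
    intro y hy hsub
    have := Finset.card_le_card hsub
    rw [hmin.blob.card_erase hy] at this
    omega
  by_cases hall : ∃ y ∈ P, y ∉ core (freeBlobs G) P
  · obtain ⟨y, hy, hyc⟩ := hall
    refine bound y hy fun w hw => ?_
    rw [Finset.mem_erase, mem_closedNbrs] at hw
    exact hindep y hy hyc w hw.2.1 (hw.2.2.resolve_left hw.1)
  · push Not at hall
    obtain ⟨y, hy⟩ := hmin.nonempty
    refine bound y hy fun w hw => hall w ?_
    exact (mem_closedNbrs.1 (Finset.mem_of_mem_erase hw)).1

theorem meetsTrans_freeBlobs (hd : ∀ v, (nbrs G v).card ≤ 6) : MeetsTrans (freeBlobs G) := by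
  intro A hA B hB C hC hAB hBC
  obtain ⟨v, hv⟩ := Finset.card_pos.1
    (lt_of_lt_of_le (by norm_num) (three_le_card_core hd hB) : 0 < (core (freeBlobs G) B).card)
  rw [mem_core] at hv
  exact ⟨v, Finset.mem_inter.2 ⟨hv A hA (by rwa [Finset.inter_comm]), hv C hC hBC⟩⟩

/-- In a graph of maximum degree at most `6` without `6`-clique a maximal independent set hits all
`5`-cliques and all minimal blob sets that meet no `5`-clique. -/
theorem exists_maximal_independent_hitting_freeBlobs (hd : ∀ v, (nbrs G v).card ≤ 6)
    (hf : G.CliqueFree 6) :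
    ∃ I : Finset V, (∀ x ∈ I, ∀ y ∈ I, ¬ G.Adj x y) ∧ (∀ v, v ∉ I → ∃ u ∈ I, G.Adj v u) ∧
      (∀ A : Finset V, G.IsNClique 5 A → ∃ v ∈ A, v ∈ I) ∧ ∀ P ∈ freeBlobs G, ∃ v ∈ P, v ∈ I := by
  classical
  have hs := cliqueSystem_cliques (q := 5) hd hf
  have ht := meetsTrans_freeBlobs hd
  have hne : ∀ P ∈ freeBlobs G, P.Nonempty := fun P hP => (mem_freeBlobs.1 hP).1.nonempty
  -- Cores of free blobs have at least three vertices, each with at most one neighbour outside its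
  -- blob; this is what `CliqueSystem.exists_hitting` asks of the extra family.
  let o : Finset V → V → Finset V := fun A v =>
    if hA : ∃ P ∈ freeBlobs G, core (freeBlobs G) P = A then nbrs G v \ hA.choose else ∅
  have ho : ∀ A ∈ (freeBlobs G).image (core (freeBlobs G)), ∃ P ∈ freeBlobs G,
      core (freeBlobs G) P = A ∧ ∀ v, o A v = nbrs G v \ P := by
    intro A hA
    obtain ⟨P, hP, hPA⟩ := Finset.mem_image.1 hA
    have hex : ∃ P ∈ freeBlobs G, core (freeBlobs G) P = A := ⟨P, hP, hPA⟩
    refine ⟨hex.choose, hex.choose_spec.1, hex.choose_spec.2, fun v => ?_⟩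
    simp only [o, hex, dif_pos]
  obtain ⟨I, hI, hhit, hhitW⟩ := hs.exists_hitting (by norm_num) (hs.meetsTrans le_rfl)
    ((freeBlobs G).image (core (freeBlobs G)))
    (by
      intro A hA
      obtain ⟨P, hP, rfl⟩ := Finset.mem_image.1 hA
      exact three_le_card_core hd hP)
    (by
      intro A hA B hB hAB
      obtain ⟨P, hP, rfl⟩ := Finset.mem_image.1 hA
      obtain ⟨P', hP', rfl⟩ := Finset.mem_image.1 hB
      exact Finset.disjoint_of_subset_left (core_subset_reach hP (hne P hP))
        (disjoint_reach_core ht hne hP hP' hAB))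
    (by
      intro A hA B hB
      obtain ⟨P, hP, rfl⟩ := Finset.mem_image.1 hA
      exact Finset.disjoint_of_subset_left (core_subset hP (hne P hP))
        ((mem_freeBlobs.1 hP).2 B (mem_cliques.1 hB)))
    o
    (by
      intro A hA v hv
      obtain ⟨P, hP, rfl, hoe⟩ := ho A hA
      rw [hoe]
      exact (mem_freeBlobs.1 hP).1.blob.card_nbrs_sdiff hd (core_subset hP (hne P hP) hv))
    (by
      intro A hA v hv B hB hBA w hw hvw
      obtain ⟨P, hP, rfl, hoe⟩ := ho A hA
      obtain ⟨P', hP', rfl⟩ := Finset.mem_image.1 hB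
      rw [hoe, Finset.mem_sdiff, mem_nbrs]
      refine ⟨hvw, fun hwP => hBA (core_eq_of_meets ht hP' hP ⟨w, ?_⟩)⟩
      exact Finset.mem_inter.2 ⟨core_subset hP' (hne P' hP') hw, hwP⟩)
    (by
      intro A hA v hv B hB w hw hvw
      obtain ⟨P, hP, rfl, hoe⟩ := ho A hA
      rw [hoe, Finset.mem_sdiff, mem_nbrs]
      exact ⟨hvw, fun hwP =>
        Finset.disjoint_left.1 ((mem_freeBlobs.1 hP).2 B (mem_cliques.1 hB)) hwP hw⟩)
  obtain ⟨J, hIJ, hJ, hmax⟩ := exists_maximal_independent hI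
  refine ⟨J, hJ, hmax, fun A hA => ?_, fun P hP => ?_⟩
  · obtain ⟨v, hv, hvI⟩ := hhit A (mem_cliques.2 hA)
    exact ⟨v, hv, hIJ hvI⟩
  · obtain ⟨v, hv, hvI⟩ := hhitW _ (Finset.mem_image_of_mem _ hP)
    exact ⟨v, core_subset hP (hne P hP) hv, hIJ hvI⟩

end blobs

/-! ### Exchanges that hit the remaining blobs, and the colouring. -/

section exchange

variable {V : Type*} [DecidableEq V] [Fintype V] {G : SimpleGraph V} {P : Finset V}

/-- A vertex `u` outside a blob set `P` with a clique of four neighbours in `P` can be exchanged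
for some of these neighbours. -/
theorem IsBlobSet.exists_exchange (hP : IsBlobSet G P) (hd : ∀ v, (nbrs G v).card ≤ 6)
    (hf : G.CliqueFree 6) (hfree : ∀ Q : Finset V, G.IsNClique 5 Q → ¬ Q ⊆ P) {u : V}
    (huP : u ∉ P) {R : Finset V} (hR : G.IsNClique 4 R) (hRP : R ⊆ P) (hRu : R ⊆ nbrs G u) :
    ∃ J ⊆ P, J ⊆ nbrs G u ∧ J.Nonempty ∧ (∀ x ∈ J, ∀ y ∈ J, ¬ G.Adj x y) ∧
      (∀ Q : Finset V, G.IsNClique 5 Q → u ∈ Q → ¬ Disjoint Q J) ∧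
      ∀ P' : Finset V, IsBlobSet G P' → u ∈ P' → ¬ Disjoint P' J := by
  have inP : ∀ p ∈ P, G.Adj u p → ∀ w, G.Adj p w → w ≠ u → w ∈ P := by
    intro p hp hup w hpw hwu
    by_contra hw
    exact hwu (hP.outside_unique hd hp hw huP hpw hup.symm)
  have adjR : ∀ r ∈ R, G.Adj u r := fun r hr => mem_nbrs.1 (hRu hr)
  by_cases hT : nbrs G u ∩ P ⊆ R
  · obtain ⟨c, hc⟩ := Finset.card_pos.1 (by rw [hR.2]; norm_num : 0 < R.card)
    have hcu := adjR c hc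
    have small : (nbrs G u \ R).card ≤ 2 := by
      rw [Finset.card_sdiff_of_subset hRu, hR.2]
      have := hd u
      omega
    -- Only two neighbours of `u` can lie outside `R`, so `K` meets `R`; a vertex of `R` has no
    -- neighbour outside `P` but `u`, which pulls the rest of `K` into `R`. This leaves no room for
    -- a 5-clique, nor for two different 4-cliques.
    have key : ∀ K : Finset V, G.IsClique (K : Set V) → u ∈ K → 4 ≤ K.card → c ∉ K →
        K ⊆ insert u (R.erase c) := by
      intro K hK huK hcard hcK
      have hKu : K.erase u ⊆ nbrs G u := by
        intro w hw
        rw [Finset.mem_erase] at hw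
        exact mem_nbrs.2 (hK huK hw.2 hw.1.symm)
      have hmeet : ∃ r ∈ K.erase u, r ∈ R := by
        by_contra hcon
        push Not at hcon
        have h1 : K.erase u ⊆ nbrs G u \ R := fun w hw =>
          Finset.mem_sdiff.2 ⟨hKu hw, hcon w hw⟩
        have h2 := Finset.card_le_card h1
        rw [Finset.card_erase_of_mem huK] at h2
        omega
      obtain ⟨r, hrK, hrR⟩ := hmeet
      intro w hw
      by_cases hwu : w = u
      · simp [hwu]
      refine Finset.mem_insert_of_mem (Finset.mem_erase.2 ⟨fun hh => hcK (hh ▸ hw), ?_⟩)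
      by_cases hwr : w = r
      · exact hwr ▸ hrR
      have hwn := hKu (Finset.mem_erase.2 ⟨hwu, hw⟩)
      refine hT (Finset.mem_inter.2 ⟨hwn, ?_⟩)
      exact inP r (hRP hrR) (adjR r hrR) w
        (hK (Finset.mem_of_mem_erase hrK) hw (Ne.symm hwr)) hwu
    have cins : (insert u (R.erase c)).card ≤ 4 := by
      have h1 := Finset.card_insert_le u (R.erase c)
      rw [Finset.card_erase_of_mem hc, hR.2] at h1
      omega
    refine ⟨{c}, by simpa using hRP hc, by simpa [mem_nbrs] using hcu, by simp, by simp, ?_, ?_⟩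
    · intro Q hQ huQ hdis
      have h1 := Finset.card_le_card (key Q hQ.1 huQ (by rw [hQ.2]; norm_num)
        (by simpa using hdis))
      rw [hQ.2] at h1
      omega
    · intro P' hP' huP' hdis
      rw [Finset.disjoint_singleton_right] at hdis
      obtain ⟨A, B, hA, hB, hAP, hBP, huA, huB, hAB, -⟩ := hP' u huP'
      have eA := Finset.eq_of_subset_of_card_le
        (key A hA.1 huA hA.2.ge (fun hh => hdis (hAP hh))) (by rw [hA.2]; exact cins)
      have eB := Finset.eq_of_subset_of_card_le
        (key B hB.1 huB hB.2.ge (fun hh => hdis (hBP hh))) (by rw [hB.2]; exact cins)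
      rw [eB, ← eA, Finset.inter_self, hA.2] at hAB
      omega
  · obtain ⟨x, hxT, hxR⟩ := Finset.not_subset.1 hT
    rw [Finset.mem_inter, mem_nbrs] at hxT
    obtain ⟨hux, hxP⟩ := hxT
    -- Without `c` and `d`, `u` keeps at most four neighbours: too few for a blob set, and enough
    -- for a 5-clique only if they form a 4-clique.
    suffices H : ∃ c ∈ P, ∃ d ∈ P, G.Adj u c ∧ G.Adj u d ∧ c ≠ d ∧ ¬ G.Adj c d ∧
        ¬ G.IsNClique 4 (nbrs G u \ {c, d}) by
      obtain ⟨c, hcP, d, hdP, huc, hud, hcd, hncd, hno⟩ := H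
      have hsub : ({c, d} : Finset V) ⊆ nbrs G u := by
        intro w hw
        rw [Finset.mem_insert, Finset.mem_singleton] at hw
        rcases hw with rfl | rfl
        · exact mem_nbrs.2 huc
        · exact mem_nbrs.2 hud
      have small : (nbrs G u \ {c, d}).card ≤ 4 := by
        rw [Finset.card_sdiff_of_subset hsub, Finset.card_pair hcd]
        have := hd u
        omega
      refine ⟨{c, d}, ?_, hsub, by simp, ?_, ?_, ?_⟩
      · intro w hw
        rw [Finset.mem_insert, Finset.mem_singleton] at hw
        rcases hw with rfl | rfl
        · exact hcP
        · exact hdP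
      · intro a ha b hb
        rw [Finset.mem_insert, Finset.mem_singleton] at ha hb
        rcases ha with rfl | rfl <;> rcases hb with rfl | rfl
        · exact G.loopless.irrefl _
        · exact hncd
        · exact fun hh => hncd hh.symm
        · exact G.loopless.irrefl _
      · intro Q hQ huQ hdis
        have hQc : (Q.erase u).card = 4 := by rw [Finset.card_erase_of_mem huQ, hQ.2]
        have h1 : Q.erase u ⊆ nbrs G u \ {c, d} := by
          intro w hw
          rw [Finset.mem_erase] at hw
          exact Finset.mem_sdiff.2 ⟨mem_nbrs.2 (hQ.1 huQ hw.2 hw.1.symm),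
            Finset.disjoint_left.1 hdis hw.2⟩
        have h2 := Finset.eq_of_subset_of_card_le h1 (by rw [hQc]; exact small)
        refine hno (h2 ▸ ⟨hQ.1.subset ?_, hQc⟩)
        exact_mod_cast Finset.erase_subset u Q
      · intro P' hP' huP' hdis
        have h1 := hP'.card_erase huP'
        have h2 : (closedNbrs G P' u).erase u ⊆ nbrs G u \ {c, d} := by
          intro w hw
          refine Finset.mem_sdiff.2 ⟨closedNbrs_subset u hw, ?_⟩
          exact Finset.disjoint_left.1 hdis (mem_closedNbrs.1 (Finset.mem_of_mem_erase hw)).1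
        have h3 := Finset.card_le_card h2
        omega
    by_contra hcon
    push Not at hcon
    have nonadj : ∀ y ∈ P, G.Adj u y → y ∉ R → ∃ c ∈ R, ¬ G.Adj y c := by
      intro y hy huy hyR
      by_contra hall
      push Not at hall
      have h5 : G.IsNClique 5 (insert y R) := hR.insert hall
      refine hf _ (h5.insert (a := u) fun b hb => ?_)
      rcases Finset.mem_insert.1 hb with rfl | hb
      · exact huy
      · exact adjR b hb
    -- the four-clique left over when `y ∉ R` and a non-neighbour `c ∈ R` are removed
    have left : ∀ y ∈ P, G.Adj u y → y ∉ R → ∀ c ∈ R, ¬ G.Adj y c →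
        ∃ z ∈ P, G.Adj u z ∧ z ∉ R ∧ z ≠ y ∧ ∀ r ∈ R.erase c, G.Adj z r := by
      intro y hy huy hyR c hc hyc
      have hyc' : y ≠ c := fun hh => hyR (hh ▸ hc)
      have h4 := hcon y hy c (hRP hc) huy (adjR c hc) hyc' hyc
      have hsub : R.erase c ⊆ nbrs G u \ {y, c} := by
        intro w hw
        rw [Finset.mem_erase] at hw
        refine Finset.mem_sdiff.2 ⟨hRu hw.2, ?_⟩
        rw [Finset.mem_insert, Finset.mem_singleton, not_or]
        exact ⟨fun hh => hyR (hh ▸ hw.2), hw.1⟩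
      have c3 : (R.erase c).card = 3 := by rw [Finset.card_erase_of_mem hc, hR.2]
      obtain ⟨z, hz, hzR⟩ := Finset.exists_mem_notMem_of_card_lt_card
        (by rw [c3, h4.2]; norm_num : (R.erase c).card < (nbrs G u \ {y, c}).card)
      have hadj : ∀ r ∈ R.erase c, G.Adj z r := fun r hr =>
        h4.1 hz (hsub hr) (fun hh => hzR (hh ▸ hr))
      rw [Finset.mem_sdiff, mem_nbrs, Finset.mem_insert, Finset.mem_singleton, not_or] at hz
      obtain ⟨r, hr⟩ := Finset.card_pos.1 (by rw [c3]; norm_num : 0 < (R.erase c).card)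
      have hrR := Finset.mem_of_mem_erase hr
      refine ⟨z, ?_, hz.1, ?_, hz.2.1, hadj⟩
      · exact inP r (hRP hrR) (adjR r hrR) z (hadj r hr).symm hz.1.ne'
      · exact fun hh => hzR (Finset.mem_erase.2 ⟨hz.2.2, hh⟩)
    obtain ⟨c, hc, hxc⟩ := nonadj x hxP hux hxR
    obtain ⟨y, hyP, huy, hyR, hyx, hyadj⟩ := left x hxP hux hxR c hc hxc
    obtain ⟨d, hdR, hyd⟩ := nonadj y hyP huy hyR
    have hdc : d = c := by
      by_contra hne
      exact hyd (hyadj d (Finset.mem_erase.2 ⟨hne, hdR⟩))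
    rw [hdc] at hyd
    obtain ⟨z, hzP, huz, hzR, hzy, hzadj⟩ := left y hyP huy hyR c hc hyd
    have c3 : (R.erase c).card = 3 := by rw [Finset.card_erase_of_mem hc, hR.2]
    obtain ⟨r, hr⟩ := Finset.card_pos.1 (by rw [c3]; norm_num : 0 < (R.erase c).card)
    have hrP := hRP (Finset.mem_of_mem_erase hr)
    obtain ⟨t, -, -, -, huniv⟩ := hP.exists_twin hfree hrP
    obtain ⟨-, -, -, -, -, -, -, -, -, -, hc6⟩ := hP.exists_cliques hrP
    have hadjR : ∀ s ∈ R.erase c, ∀ w ∈ R, w = s ∨ G.Adj s w := fun s hs w hw =>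
      adj_or_eq_of_clique hR (Finset.mem_of_mem_erase hs) hw
    have hW : ∀ s ∈ R.erase c, ∀ w ∈ insert z (insert y R), w = s ∨ G.Adj s w := by
      intro s hs w hw
      rw [Finset.mem_insert, Finset.mem_insert] at hw
      rcases hw with rfl | rfl | hw
      · exact Or.inr (hzadj s hs).symm
      · exact Or.inr (hyadj s hs).symm
      · exact hadjR s hs w hw
    have heq : insert z (insert y R) = closedNbrs G P r := by
      refine Finset.eq_of_subset_of_card_le ?_ ?_
      · intro w hw
        rw [mem_closedNbrs]
        refine ⟨?_, hW r hr w hw⟩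
        rw [Finset.mem_insert, Finset.mem_insert] at hw
        rcases hw with rfl | rfl | hw
        exacts [hzP, hyP, hRP hw]
      · rw [hc6, Finset.card_insert_of_notMem, Finset.card_insert_of_notMem hyR, hR.2]
        rw [Finset.mem_insert, not_or]
        exact ⟨hzy, hzR⟩
    -- The three vertices of `R` other than `c` are all universal in the closed neighbourhood of
    -- `r`, but only `r` and its twin can be.
    have hsub : R.erase c ⊆ {r, t} := by
      intro s hs
      rw [Finset.mem_insert, Finset.mem_singleton]
      refine huniv s ?_ ?_
      · rw [← heq]
        exact Finset.mem_insert_of_mem (Finset.mem_insert_of_mem (Finset.mem_of_mem_erase hs))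
      · rw [← heq]
        exact hW s hs
    have := (Finset.card_le_card hsub).trans Finset.card_le_two
    omega

/-- In a graph of maximum degree at most `6` without `6`-clique a maximal independent set hits all
`5`-cliques and all minimal blob sets. -/
theorem exists_maximal_independent_hitting_blobs (hd : ∀ v, (nbrs G v).card ≤ 6)
    (hf : G.CliqueFree 6) :
    ∃ I : Finset V, (∀ x ∈ I, ∀ y ∈ I, ¬ G.Adj x y) ∧ (∀ v, v ∉ I → ∃ u ∈ I, G.Adj v u) ∧
      (∀ A : Finset V, G.IsNClique 5 A → ∃ v ∈ A, v ∈ I) ∧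
      ∀ P, IsMinBlobSet G P → ¬ Disjoint P I := by
  classical
  suffices H : ∀ n : ℕ, ∀ I : Finset V, (∀ x ∈ I, ∀ y ∈ I, ¬ G.Adj x y) →
      (∀ v, v ∉ I → ∃ u ∈ I, G.Adj v u) → (∀ A : Finset V, G.IsNClique 5 A → ∃ v ∈ A, v ∈ I) →
      (∀ P ∈ freeBlobs G, ∃ v ∈ P, v ∈ I) →
      (Finset.univ.filter (fun P => IsMinBlobSet G P ∧ Disjoint P I)).card = n →
      ∃ I : Finset V, (∀ x ∈ I, ∀ y ∈ I, ¬ G.Adj x y) ∧ (∀ v, v ∉ I → ∃ u ∈ I, G.Adj v u) ∧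
        (∀ A : Finset V, G.IsNClique 5 A → ∃ v ∈ A, v ∈ I) ∧
        ∀ P, IsMinBlobSet G P → ¬ Disjoint P I by
    obtain ⟨I, h1, h2, h3, h4⟩ := exists_maximal_independent_hitting_freeBlobs hd hf
    exact H _ I h1 h2 h3 h4 rfl
  intro n
  induction n using Nat.strong_induction_on with
  | _ n ih =>
  intro I hI hmax h5 hfb hn
  by_cases hdone : ∀ P, IsMinBlobSet G P → ¬ Disjoint P I
  · exact ⟨I, hI, hmax, h5, hdone⟩
  push Not at hdone
  obtain ⟨P, hP, hPI⟩ := hdone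
  have hmeet : ∃ Q : Finset V, G.IsNClique 5 Q ∧ ¬ Disjoint P Q := by
    by_contra hcon
    push Not at hcon
    obtain ⟨v, hv, hvI⟩ := hfb P (mem_freeBlobs.2 ⟨hP, hcon⟩)
    exact Finset.disjoint_left.1 hPI hv hvI
  obtain ⟨Q, hQ, hQP⟩ := hmeet
  obtain ⟨v, hvP, hvQ⟩ := Finset.not_disjoint_iff.1 hQP
  obtain ⟨u, huQ, huI⟩ := h5 Q hQ
  have huP : u ∉ P := fun hh => Finset.disjoint_left.1 hPI hh huI
  have hfree : ∀ Q : Finset V, G.IsNClique 5 Q → ¬ Q ⊆ P := by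
    intro Q hQ hsub
    obtain ⟨w, hw, hwI⟩ := h5 Q hQ
    exact Finset.disjoint_left.1 hPI (hsub hw) hwI
  have hvu : G.Adj v u := hQ.1 hvQ huQ (fun hh => huP (hh ▸ hvP))
  have hR : G.IsNClique 4 (Q.erase u) := by
    refine ⟨hQ.1.subset ?_, by rw [Finset.card_erase_of_mem huQ, hQ.2]⟩
    exact_mod_cast Finset.erase_subset u Q
  have hRP : Q.erase u ⊆ P := by
    intro w hw
    rw [Finset.mem_erase] at hw
    by_contra hwP
    refine hw.1 (hP.blob.outside_unique hd hvP hwP huP ?_ hvu)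
    exact hQ.1 hvQ hw.2 (fun hh => hwP (hh ▸ hvP))
  have hRu : Q.erase u ⊆ nbrs G u := by
    intro w hw
    rw [Finset.mem_erase] at hw
    exact mem_nbrs.2 (hQ.1 huQ hw.2 hw.1.symm)
  obtain ⟨J, hJP, hJu, hJne, hJ, hJ5, hJb⟩ :=
    hP.blob.exists_exchange hd hf hfree huP hR hRP hRu
  -- The only neighbour of `j` outside `P` is `u`, and `I` avoids `P`.
  have hJI : ∀ j ∈ J, ∀ w ∈ I.erase u, ¬ G.Adj j w := by
    intro j hj w hw hjw
    rw [Finset.mem_erase] at hw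
    have hwP : w ∉ P := fun hh => Finset.disjoint_left.1 hPI hh hw.2
    exact hw.1 (hP.blob.outside_unique hd (hJP hj) hwP huP hjw (mem_nbrs.1 (hJu hj)).symm)
  have hind : ∀ x ∈ I.erase u ∪ J, ∀ y ∈ I.erase u ∪ J, ¬ G.Adj x y := by
    intro x hx y hy
    rcases Finset.mem_union.1 hx with hx | hx <;> rcases Finset.mem_union.1 hy with hy | hy
    · exact hI x (Finset.mem_of_mem_erase hx) y (Finset.mem_of_mem_erase hy)
    · exact fun hh => hJI y hy x hx hh.symm
    · exact hJI x hx y hy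
    · exact hJ x hx y hy
  obtain ⟨I', hsub, hI', hmax'⟩ := exists_maximal_independent hind
  have keep : ∀ w ∈ I, w ≠ u → w ∈ I' := fun w hw hwu =>
    hsub (Finset.mem_union_left _ (Finset.mem_erase.2 ⟨hwu, hw⟩))
  have hJI' : J ⊆ I' := Finset.subset_union_right.trans hsub
  refine ih _ ?_ I' hI' hmax' ?_ ?_ rfl
  · rw [← hn]
    refine Finset.card_lt_card (Finset.ssubset_iff_of_subset ?_ |>.2 ⟨P, ?_, ?_⟩)
    · intro P' hP'
      obtain ⟨hP', hdis⟩ := (Finset.mem_filter.1 hP').2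
      refine Finset.mem_filter.2 ⟨Finset.mem_univ _, hP', ?_⟩
      rw [Finset.disjoint_left]
      intro w hw hwI
      by_cases hwu : w = u
      · exact hJb P' hP'.blob (hwu ▸ hw) (Finset.disjoint_of_subset_right hJI' hdis)
      · exact Finset.disjoint_left.1 hdis hw (keep w hwI hwu)
    · exact Finset.mem_filter.2 ⟨Finset.mem_univ _, hP, hPI⟩
    · intro hh
      obtain ⟨-, hdis⟩ := (Finset.mem_filter.1 hh).2
      obtain ⟨j, hj⟩ := hJne
      exact Finset.disjoint_left.1 hdis (hJP hj) (hJI' hj)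
  · intro A hA
    obtain ⟨w, hw, hwI⟩ := h5 A hA
    by_cases hwu : w = u
    · obtain ⟨j, hjA, hj⟩ := Finset.not_disjoint_iff.1 (hJ5 A hA (hwu ▸ hw))
      exact ⟨j, hjA, hJI' hj⟩
    · exact ⟨w, hw, keep w hwI hwu⟩
  · intro P' hP'
    obtain ⟨w, hw, hwI⟩ := hfb P' hP'
    refine ⟨w, hw, keep w hwI fun hwu => ?_⟩
    -- Free blobs meet no 5-clique, so `u` was not the vertex hitting them.
    exact Finset.disjoint_left.1 ((mem_freeBlobs.1 hP').2 Q hQ) hw (hwu ▸ huQ)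

theorem hasMixedColoring_two (hd : ∀ v, (nbrs G v).card ≤ 6) (hf : G.CliqueFree 6) :
    HasMixedColoring G 2 := by
  obtain ⟨I, hI, hmax, h5, hb⟩ := exists_maximal_independent_hitting_blobs hd hf
  have hd' := card_nbrs_isolate_le (d := 5) hd hmax
  obtain ⟨I', hI', h4⟩ := exists_independent_hitting_four_cliques hd'
    (cliqueFree_isolate (by norm_num) h5) (by
      intro P hPne hP
      have hPI : Disjoint P I := by
        rw [Finset.disjoint_left]
        intro v hv
        obtain ⟨A, hA, -, -, -, -, hvA, -, -⟩ := hP v hv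
        exact notMem_of_isolate_clique (by norm_num) (mem_cliques.1 hA) hvA
      -- In the reduced graph two 4-cliques sharing two vertices fill the closed neighbourhood. `P`
      -- avoids `I`, so no edge of `G` inside `P` was deleted, and a closed set is a blob set of
      -- `G`.
      have hblob : IsBlobSet G P := by
        intro v hv
        obtain ⟨A, hA, B, hB, hAP, hBP, hvA, hvB, hAB⟩ := hP v hv
        rw [mem_cliques] at hA hB
        refine ⟨A, B, isNClique_of_isolate hA, isNClique_of_isolate hB, hAP, hBP, hvA, hvB, hAB,
          fun w hw hvw => ?_⟩
        have heq : A ∪ B = insert v (nbrs (isolate G I) v) := by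
          refine Finset.eq_of_subset_of_card_le (Finset.union_subset
            (clique_subset_insert_nbrs hA.1 hvA) (clique_subset_insert_nbrs hB.1 hvB)) ?_
          have h1 := card_union_four hA hB hAB
          have h2 := hd' v
          rw [card_insert_nbrs]
          omega
        rw [heq]
        exact Finset.mem_insert_of_mem (mem_nbrs.2 ⟨hvw, Finset.disjoint_left.1 hPI hv,
          Finset.disjoint_left.1 hPI hw⟩)
      obtain ⟨P', hsub, hP'⟩ := hblob.exists_min hPne
      exact hb P' hP' (Finset.disjoint_of_subset_left hsub hPI))
  exact ((hasMixedColoring_zero (cliqueFree_isolate (by norm_num) h4)).of_isolate hI').of_isolate hI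

/-- A graph of maximum degree at most `m + 4` without `(m + 4)`-clique, `m ≥ 2`, is the union of
`m` independent sets and a set spanning no `4`-clique. -/
theorem hasMixedColoring_of_cliqueFree {m : ℕ} (hm : 2 ≤ m) :
    ∀ G : SimpleGraph V, (∀ v, (nbrs G v).card ≤ m + 4) → G.CliqueFree (m + 4) →
      HasMixedColoring G m := by
  induction m, hm using Nat.le_induction with
  | base => exact fun G hd hf => hasMixedColoring_two hd hf
  | succ m hm ih =>
    intro G hd hf
    have e : m + 1 + 4 = (m + 4) + 1 := by omega
    rw [e] at hf
    simp only [e] at hd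
    obtain ⟨I, hI, hmax, hq⟩ := exists_maximal_independent_hitting_cliques (q := m + 4) (by omega)
      hd hf
    exact (ih _ (card_nbrs_isolate_le hd hmax) (cliqueFree_isolate (by omega) hq)).of_isolate hI

end exchange

/-! ### Merging colour classes, and the theorem. -/

/-- The fibres of a map to `Fin k` can be made non-empty by moving single points. -/
theorem exists_surjective_of_card_le {V : Type*} [Fintype V] {k : ℕ} (hk : k ≤ Fintype.card V)
    (f : V → Fin k) : ∃ g : V → Fin k, Function.Surjective g ∧
      ∀ i, (∀ v, g v = i → f v = i) ∨ ∀ v w, g v = i → g w = i → v = w := by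
  classical
  induction h : (Finset.univ \ Finset.univ.image f).card using Nat.strong_induction_on
    generalizing f with
  | _ n ih =>
  by_cases hs : Function.Surjective f
  · exact ⟨f, hs, fun i => Or.inl fun v hv => hv⟩
  have hmiss : ∃ i, ∀ v, f v ≠ i := by
    by_contra hcon
    push Not at hcon
    exact hs hcon
  obtain ⟨i, hi⟩ := hmiss
  have hninj : ¬ Function.Injective f := by
    intro hinj
    have h1 : Finset.univ.image f ⊆ Finset.univ.erase i := by
      intro j hj
      obtain ⟨v, -, rfl⟩ := Finset.mem_image.1 hj
      exact Finset.mem_erase.2 ⟨hi v, Finset.mem_univ _⟩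
    have h2 := Finset.card_le_card h1
    rw [Finset.card_image_of_injective _ hinj, Finset.card_erase_of_mem (Finset.mem_univ i),
      Finset.card_univ, Finset.card_univ, Fintype.card_fin] at h2
    have := i.pos
    omega
  rw [Function.not_injective_iff] at hninj
  -- Since `a` shares its fibre with `b`, moving `a` to the empty fibre `i` empties no fibre.
  obtain ⟨a, b, hab, hne⟩ := hninj
  have hf' : ∀ j, (∀ v, Function.update f a i v = j → f v = j) ∨
      ∀ v w, Function.update f a i v = j → Function.update f a i w = j → v = w := by
    intro j
    by_cases hj : j = i
    · right
      have : ∀ v, Function.update f a i v = j → v = a := by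
        intro v hv
        by_contra hva
        rw [Function.update_of_ne hva] at hv
        exact hi v (hv.trans hj)
      intro v w hv hw
      rw [this v hv, this w hw]
    · left
      intro v hv
      by_cases hva : v = a
      · rw [hva, Function.update_self] at hv
        exact (hj hv.symm).elim
      · rwa [Function.update_of_ne hva] at hv
  have hlt : (Finset.univ \ Finset.univ.image (Function.update f a i)).card < n := by
    rw [← h]
    refine Finset.card_lt_card (Finset.ssubset_iff_of_subset ?_ |>.2 ⟨i, ?_, ?_⟩)
    · intro j hj
      rw [Finset.mem_sdiff] at hj ⊢
      refine ⟨hj.1, fun hj' => hj.2 ?_⟩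
      obtain ⟨v, -, rfl⟩ := Finset.mem_image.1 hj'
      by_cases hva : v = a
      · refine Finset.mem_image.2 ⟨b, Finset.mem_univ _, ?_⟩
        rw [Function.update_of_ne hne.symm, hva, hab]
      · exact Finset.mem_image.2 ⟨v, Finset.mem_univ _, Function.update_of_ne hva _ _⟩
    · rw [Finset.mem_sdiff]
      refine ⟨Finset.mem_univ _, fun hh => ?_⟩
      obtain ⟨v, -, hv⟩ := Finset.mem_image.1 hh
      exact hi v hv
    · rw [Finset.mem_sdiff, not_and, not_not]
      exact fun _ => Finset.mem_image.2 ⟨a, Finset.mem_univ _, Function.update_self _ _ _⟩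
  obtain ⟨g, hg, hgf⟩ := ih _ hlt _ rfl
  refine ⟨g, hg, fun j => ?_⟩
  rcases hgf j with h1 | h1
  · rcases hf' j with h2 | h2
    · exact Or.inl fun v hv => h2 v (h1 v hv)
    · exact Or.inr fun v w hv hw => h2 v w (h1 v hv) (h1 w hw)
  · exact Or.inr h1

/-- An assignment of `m = ∑ s i` objects to `k` places, with `s i` slots at place `i`. -/
theorem exists_slots {k m : ℕ} (s : Fin k → ℕ) (hm : ∑ i, s i = m) :
    ∃ t : Fin m → Fin k × ℕ, Function.Injective t ∧ ∀ x, (t x).2 < s (t x).1 := by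
  subst hm
  refine ⟨fun x => ((finSigmaFinEquiv.symm x).1, ((finSigmaFinEquiv.symm x).2 : ℕ)), ?_,
    fun x => (finSigmaFinEquiv.symm x).2.isLt⟩
  intro x y hxy
  apply finSigmaFinEquiv.symm.injective
  rw [Prod.mk.injEq] at hxy
  generalize finSigmaFinEquiv.symm x = a at hxy ⊢
  generalize finSigmaFinEquiv.symm y = b at hxy ⊢
  obtain ⟨a1, a2⟩ := a
  obtain ⟨b1, b2⟩ := b
  obtain ⟨h1, h2⟩ := hxy
  dsimp only at h1 h2
  subst h1
  rw [Fin.ext h2]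

/-- Merging the classes of a mixed colouring into a partition with prescribed clique bounds. -/
theorem HasMixedColoring.exists_partition {V : Type*} [Fintype V] {G : SimpleGraph V} {m k : ℕ}
    (h : HasMixedColoring G m) (hk : 0 < k) (hkV : k ≤ Fintype.card V) (p : Fin k → ℕ)
    (hp : ∀ i, 2 ≤ p i) (hp0 : 4 ≤ p ⟨0, hk⟩) (hsum : ∑ i, p i = m + 3 + k) :
    ∃ W : Fin k → Set V, IsVertexPartition W ∧ ∀ i, (G.induce (W i)).CliqueFree (p i) := by
  classical
  obtain ⟨c, hc, hprop, h4⟩ := h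
  let i0 : Fin k := ⟨0, hk⟩
  -- Place `i` has room for cliques of size p_i - 1: at `i0`, three of these are reserved for colour
  -- `0`; the remaining `s i` are slots for proper colours.
  let r : Fin k → ℕ := fun i => if i = i0 then 3 else 0
  let s : Fin k → ℕ := fun i => p i - 1 - r i
  have hs : ∀ i, s i + r i + 1 = p i := by
    intro i
    have := hp i
    by_cases hi : i = i0
    · have : 4 ≤ p i := hi ▸ hp0
      simp only [s, r, hi, if_true] at this ⊢
      omega
    · simp only [s, r, hi, if_false]
      omega
  have hsm : ∑ i, s i = m := by
    have h1 : ∑ i, (s i + r i + 1) = m + 3 + k := by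
      rw [← hsum]
      exact Finset.sum_congr rfl fun i _ => hs i
    rw [Finset.sum_add_distrib, Finset.sum_add_distrib] at h1
    have h2 : ∑ i, r i = 3 := by simp [r]
    have h3 : ∑ _i : Fin k, 1 = k := by simp
    omega
  obtain ⟨t, htinj, ht⟩ := exists_slots s hsm
  have hcm : ∀ v, c v ≠ 0 → c v - 1 < m := fun v hv => by
    have := hc v
    omega
  let f : V → Fin k := fun v => if hv : c v ≠ 0 then (t ⟨c v - 1, hcm v hv⟩).1 else i0
  let l : V → ℕ := fun v => if hv : c v ≠ 0 then (t ⟨c v - 1, hcm v hv⟩).2 else 0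
  have hf : ∀ i, ∀ S : Finset V, G.IsClique (S : Set V) → (∀ v ∈ S, f v = i) →
      S.card + 1 ≤ p i := by
    intro i S hS hSi
    have h1 : (S.filter (fun v => c v ≠ 0)).card ≤ s i := by
      rw [← Finset.card_range (s i)]
      refine Finset.card_le_card_of_injOn l ?_ ?_
      · intro v hv
        obtain ⟨hvS, hv⟩ := Finset.mem_filter.1 hv
        have hvi := hSi v hvS
        have := ht ⟨c v - 1, hcm v hv⟩
        simp only [f, l, hv, dif_pos, ne_eq, not_false_eq_true] at hvi ⊢
        rw [hvi] at this
        simpa using this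
      · intro v hv w hw hvw
        obtain ⟨hvS, hv⟩ := Finset.mem_filter.1 hv
        obtain ⟨hwS, hw⟩ := Finset.mem_filter.1 hw
        have hvi := hSi v hvS
        have hwi := hSi w hwS
        simp only [f, l, hv, hw, dif_pos, ne_eq, not_false_eq_true] at hvi hwi hvw
        have heq := htinj (Prod.ext (hvi.trans hwi.symm) hvw)
        rw [Fin.mk.injEq] at heq
        by_contra hne
        exact hv (hprop v w (hS hvS hwS hne) (by omega))
    have h2 : (S.filter (fun v => ¬ c v ≠ 0)).card ≤ r i := by
      by_cases hi : i = i0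
      · simp only [r, hi, if_true]
        by_contra hcon
        obtain ⟨T, hTS, hT⟩ := Finset.exists_subset_card_eq (by omega :
          4 ≤ (S.filter (fun v => ¬ c v ≠ 0)).card)
        obtain ⟨v, hv, hcv⟩ := h4 T ⟨hS.subset fun x hx =>
          (Finset.mem_filter.1 (hTS hx)).1, hT⟩
        exact (Finset.mem_filter.1 (hTS hv)).2 hcv
      · rw [Finset.filter_eq_empty_iff.2]
        · simp
        · intro v hv hcv
          have := hSi v hv
          simp only [f, hcv, dif_neg, not_false_eq_true] at this
          exact hi this.symm
    have h3 := Finset.card_filter_add_card_filter_not (s := S) (fun v => c v ≠ 0)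
    have := hs i
    omega
  obtain ⟨g, hg, hgf⟩ := exists_surjective_of_card_le hkV f
  refine ⟨fun i => {v | g v = i}, ⟨fun i => hg i, ?_, ?_⟩, ?_⟩
  · intro i j hij
    rw [Set.disjoint_left]
    intro v hv hv'
    exact hij (hv.symm.trans hv')
  · ext v
    simp
  · intro i S hS
    rw [SimpleGraph.isNClique_induce_iff] at hS
    have hmem : ∀ v ∈ S.map (Function.Embedding.subtype _), g v = i := by
      intro v hv
      obtain ⟨w, -, rfl⟩ := Finset.mem_map.1 hv
      exact w.2
    rcases hgf i with h1 | h1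
    · have := hf i _ hS.1 fun v hv => h1 v (hmem v hv)
      rw [hS.2] at this
      omega
    -- A fibre created only to be non-empty has one vertex, which is harmless since p_i ≥ 2.
    · have : (S.map (Function.Embedding.subtype _)).card ≤ 1 :=
        Finset.card_le_one.2 fun v hv w hw => h1 v w (hmem v hv) (hmem w hw)
      rw [hS.2] at this
      have := hp i
      omega

theorem hasFreePartition_of_cliqueFree {V : Type*} {G : SimpleGraph V} {p k : ℕ}
    (h : ∃ W : Fin k → Set V, IsVertexPartition W ∧ ∀ i, (G.induce (W i)).CliqueFree p) :
    HasFreePartition (SimpleGraph.completeGraph (Fin p)) G k := by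
  obtain ⟨W, hW, hfree⟩ := h
  refine ⟨W, hW, fun i hcon => ?_⟩
  exact (SimpleGraph.not_cliqueFree_iff_top_isContained p).2 hcon (hfree i)

theorem freeChromaticNumber_le {V U : Type*} {G : SimpleGraph U} {H : SimpleGraph V} {k n : ℕ}
    (h : HasFreePartition G H k) (hkn : k ≤ n) : freeChromaticNumber G H ≤ (n : ℕ∞) :=
  (iInf₂_le k h).trans (by exact_mod_cast hkn)

/-- In a graph of maximum degree at most `5` three independent sets can be removed to leave a
graph without `4`-clique. -/
theorem hasMixedColoring_three {V : Type*} [Fintype V] (G : SimpleGraph V)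
    (hd : ∀ v, (nbrs G v).card ≤ 5) : HasMixedColoring G 3 := by
  classical
  obtain ⟨I, -, hI, hImax⟩ := exists_maximal_independent (G := G) (I := ∅) (by simp)
  have hd1 := card_nbrs_isolate_le (d := 4) hd hImax
  obtain ⟨J, -, hJ, hJmax⟩ := exists_maximal_independent (G := isolate G I) (I := ∅) (by simp)
  have hd2 := card_nbrs_isolate_le (d := 3) hd1 hJmax
  obtain ⟨K, -, hK, hKmax⟩ :=
    exists_maximal_independent (G := isolate (isolate G I) J) (I := ∅) (by simp)
  have hd3 := card_nbrs_isolate_le (d := 2) hd2 hKmax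
  refine (((hasMixedColoring_zero fun S hS => ?_).of_isolate hK).of_isolate hJ).of_isolate hI
  obtain ⟨v, hv⟩ := Finset.card_pos.1 (by rw [hS.2]; norm_num : 0 < S.card)
  have h1 := Finset.card_le_card (clique_subset_insert_nbrs hS.1 hv)
  rw [card_insert_nbrs, hS.2] at h1
  -- Degree at most 2 remains, while a vertex of a 4-clique has degree 3.
  have := hd3 v
  omega

theorem theorem1 {V : Type*} [Fintype V] (H : SimpleGraph V) [DecidableRel H.Adj]
    (hω : H.cliqueNum + 1 ≤ H.maxDegree) :
    (6 ≤ H.maxDegree →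
      ∀ (k : ℕ) (hk : 0 < k) (p : Fin k → ℕ), Antitone p → (∀ i, 2 ≤ p i) → 4 ≤ p ⟨0, hk⟩ →
        ∑ i, p i = H.maxDegree - 1 + k →
        ∃ W : Fin k → Set V, IsVertexPartition W ∧ ∀ i, (H.induce (W i)).CliqueFree (p i)) ∧
    (∀ p : ℕ, 4 ≤ p →
      freeChromaticNumber (SimpleGraph.completeGraph (Fin p)) H ≤
        ((⌈((H.maxDegree : ℚ) - 1) / ((p : ℚ) - 1)⌉₊ : ℕ) : ℕ∞)) := by
  classical
  have hV : Nonempty V := by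
    by_contra hV
    rw [not_nonempty_iff] at hV
    have : H.maxDegree = 0 := by
      rw [SimpleGraph.maxDegree_eq_zero_iff]
      exact Subsingleton.elim _ _
    omega
  have hlt : H.maxDegree < Fintype.card V := H.maxDegree_lt_card_verts
  have hdeg : ∀ v, (nbrs H v).card ≤ H.maxDegree := by
    intro v
    refine le_trans (le_of_eq ?_) (H.degree_le_maxDegree v)
    rw [← SimpleGraph.card_neighborFinset_eq_degree]
    congr 1
    ext w
    simp [mem_nbrs]
  have hfree : ∀ n, H.cliqueNum < n → H.CliqueFree n := by
    intro n hn S hS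
    have := SimpleGraph.IsClique.card_le_cliqueNum (tc := hS.1)
    rw [hS.2] at this
    omega
  have hω2 : 2 ≤ H.cliqueNum := by
    have hne : H ≠ ⊥ := fun h => by
      have := H.maxDegree_eq_zero_iff.2 h
      omega
    obtain ⟨a, b, hab⟩ := SimpleGraph.ne_bot_iff_exists_adj.1 hne
    have := SimpleGraph.IsClique.card_le_cliqueNum (G := H) (t := {a, b})
      (tc := by rw [Finset.coe_pair, SimpleGraph.isClique_pair]; exact fun _ => hab)
    rwa [Finset.card_pair hab.ne] at this
  have part1 : 6 ≤ H.maxDegree →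
      ∀ (k : ℕ) (hk : 0 < k) (p : Fin k → ℕ), (∀ i, 2 ≤ p i) → 4 ≤ p ⟨0, hk⟩ →
        ∑ i, p i = H.maxDegree - 1 + k →
        ∃ W : Fin k → Set V, IsVertexPartition W ∧ ∀ i, (H.induce (W i)).CliqueFree (p i) := by
    intro h6 k hk p hp hp0 hsum
    obtain ⟨m, hm⟩ : ∃ m, H.maxDegree = m + 4 := ⟨H.maxDegree - 4, by omega⟩
    have hcol : HasMixedColoring H m := hasMixedColoring_of_cliqueFree (by omega) H
      (fun v => hm ▸ hdeg v) (hfree _ (by omega))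
    refine hcol.exists_partition hk ?_ p hp hp0 (by omega)
    -- This gives k ≤ Δ - 1 < |V|, so all parts can be non-empty.
    have : ∑ _i : Fin k, 2 ≤ ∑ i, p i := Finset.sum_le_sum fun i _ => hp i
    simp only [Finset.sum_const, Finset.card_univ, Fintype.card_fin, smul_eq_mul] at this
    omega
  refine ⟨fun h6 k hk p _ => part1 h6 k hk p, fun p hp => ?_⟩
  have le_ceil : ∀ k : ℕ, (k : ℤ) * (p - 1) < H.maxDegree - 1 →
      k + 1 ≤ ⌈((H.maxDegree : ℚ) - 1) / ((p : ℚ) - 1)⌉₊ := by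
    intro k hk
    have hp' : (0 : ℚ) < (p : ℚ) - 1 := by
      have : (4 : ℚ) ≤ p := by exact_mod_cast hp
      linarith
    rw [Nat.succ_le_iff, Nat.lt_ceil, lt_div_iff₀ hp']
    exact_mod_cast hk
  by_cases hpf : H.CliqueFree p
  -- One part suffices, and the ceiling is at least 1 because Δ > ω ≥ 2.
  · refine freeChromaticNumber_le (k := 1) (hasFreePartition_of_cliqueFree ?_)
      (le_ceil 0 (by push_cast; omega))
    refine ⟨fun _ => Set.univ, ⟨fun _ => Set.univ_nonempty, ?_, Set.iUnion_const _⟩,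
      fun _ => (SimpleGraph.cliqueFree_induce_iff ..).2 fun S _ => hpf S⟩
    intro i j hij
    exact (hij (Subsingleton.elim _ _)).elim
  have hpω : p ≤ H.cliqueNum := by
    by_contra hcon
    exact hpf (hfree p (by omega))
  by_cases h6 : 6 ≤ H.maxDegree
  · obtain ⟨d, rfl⟩ : ∃ d, p = d + 1 := ⟨p - 1, by omega⟩
    obtain ⟨D, hD⟩ : ∃ D, H.maxDegree = D + 1 := ⟨H.maxDegree - 1, by omega⟩
    have hdiv := Nat.div_add_mod D d
    have hq : 0 < D / d := Nat.div_pos (by omega) (by omega)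
    by_cases hr : D % d = 0
    · obtain ⟨n, hn⟩ : ∃ n, D / d = n + 1 := ⟨D / d - 1, by omega⟩
      rw [hn, hr] at hdiv
      refine freeChromaticNumber_le (k := n + 1) (hasFreePartition_of_cliqueFree ?_)
        (le_ceil n ?_)
      · refine part1 h6 (n + 1) (Nat.succ_pos n) (fun _ => d + 1) (fun _ => by omega) hp ?_
        simp only [Finset.sum_const, Finset.card_univ, Fintype.card_fin, smul_eq_mul, hD]
        rw [← hdiv, Nat.add_sub_cancel]
        ring
      · rw [hD, ← hdiv]
        push_cast
        have : (4 : ℤ) ≤ d + 1 := by exact_mod_cast hp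
        nlinarith
    -- With D = Δ - 1 and d = p - 1, the last part gets the bound D % d + 1. It is at least 2
    -- because the remainder is non-zero, and less than p.
    · refine freeChromaticNumber_le (k := D / d + 1) (hasFreePartition_of_cliqueFree ?_)
        (le_ceil (D / d) ?_)
      · have hmod := Nat.mod_lt D (by omega : 0 < d)
        obtain ⟨W, hW, hWf⟩ := part1 h6 (D / d + 1) (Nat.succ_pos _)
          (fun i => if (i : ℕ) < D / d then d + 1 else D % d + 1)
          (fun i => by split_ifs <;> omega)
          (by simpa [hq] using hp)
          (by
            rw [Fin.sum_univ_castSucc]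
            simp only [Fin.val_castSucc, Fin.is_lt, if_true, Fin.val_last, lt_irrefl, if_false,
              Finset.sum_const, Finset.card_univ, Fintype.card_fin, smul_eq_mul, hD]
            rw [Nat.add_sub_cancel]
            nlinarith)
        refine ⟨W, hW, fun i => (hWf i).mono ?_⟩
        split_ifs <;> omega
      · have h1 : D / d * d < D := by
          rw [Nat.mul_comm]
          omega
        rw [hD]
        push_cast
        have : ((D / d * d : ℕ) : ℤ) < D := by exact_mod_cast h1
        push_cast at this
        linarith
  -- From 4 ≤ p ≤ ω ≤ Δ - 1 ≤ 4. Two parts are needed: three proper colours in one, the remainder in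
  -- the other.
  · have h5 : H.maxDegree = 5 := by omega
    have hp4 : p = 4 := by omega
    subst hp4
    refine freeChromaticNumber_le (k := 2) (hasFreePartition_of_cliqueFree ?_)
      (le_ceil 1 (by rw [h5]; norm_num))
    exact (hasMixedColoring_three H fun v => h5 ▸ hdeg v).exists_partition (by norm_num) (by omega)
      (fun _ => 4) (by norm_num) le_rfl (by simp)
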